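/- Let $\mathcal M=(\mathcal S,\mathcal A,P,r,\gamma,\rho)$ be a Markov decision process with discount factor $\gamma\in(0,1)$, initial distribution $\rho$ and rewards $|r(s,a)|<R_0$ for all $s,a$ ($R_0>0$), and let $H$ be the horizon. Let $\pi_\theta(a|s)$, $\theta\in\mathbb R^d$, be positive policy densities (with respect to a fixed $\sigma$-finite measure on $\mathcal A$) such that $\theta\mapsto\log\pi_\theta(a|s)$ is twice differentiable with $\|\nabla\log\pi_\theta(a|s)\|\le G$ and $\|\nabla^2\log\pi_\theta(a|s)\|\le L$ for all $\theta,s,a$, where $G,L>0$ are constants. For a trajectory $\tau=(s_0,a_0,\dots,s_{H-1},a_{H-1})$ with distribution $p(\tau|\pi_\theta)$ under $\pi_\theta$, put $J(\theta)=\mathbb E_{\tau\sim\pi_\theta}\big[\sum_{h=0}^{H-1}\gamma^h r(s_h,a_h)\big]$, $\Psi_h(\tau)=\sum_{t=h}^{H-1}\gamma^t r(s_t,a_t)$, $\Phi(\theta;\tau)=\sum_{h=0}^{H-1}\Psi_h(\tau)\log\pi_\theta(a_h|s_h)$, $g(\tau;\theta)=\nabla\Phi(\theta;\tau)$ and $B(\tau;\theta)=\nabla\Phi(\theta;\tau)\,\nabla\log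 p(\tau|\pi_\theta)^{T}+\nabla^2\Phi(\theta;\tau)$. Let $\alpha_0\in(2/3,1]$, $\eta_0>0$, $\theta_0\in\mathbb R^d$, and $\alpha_t=\alpha_0/t^{2/3}$, $\eta_t=\eta_0/t^{2/3}$ for $t\ge1$. The SHARP algorithm with $T$ iterations samples $\tau_0$ with policy $\pi_{\theta_0}$ and sets $v_0=g(\tau_0;\theta_0)$, $\theta_1=\theta_0+\eta_0v_0/\|v_0\|$. For $t=1,\dots,T-1$ it samples $b_t\sim U(0,1)$ independently of the past, puts $\theta_t^b=b_t\theta_t+(1-b_t)\theta_{t-1}$, then, given the past and $b_t$, samples trajectories $\tau_t,\tau_t^b$ independently with policies $\pi_{\theta_t},\pi_{\theta_t^b}$, and sets $$v_t=(1-\alpha_t)\big(v_{t-1}+B(\tau_t^b;\theta_t^b)(\theta_t-\theta_{t-1})\big)+\alpha_t\,g(\tau_t;\theta_t),\qquad \theta_{t+1}=\theta_t+\eta_t\frac{v_t}{\|v_t\|}$$ (with $v/\|v\|:=0$ if $v=0$). Put $$\sigma_g^2=\frac{G^2R_0^2}{(1-\gamma)^4},\quad \sigma_B^2=\frac{H^2G^4R_0^2+L^2R_0^2}{(1-\gamma)^4},\quad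 C_Z=8\cdot2^{4/3}\eta_0^2\sigma_B^2+2\alpha_0^2\sigma_g^2,\quad C_Z'=\frac{C_Z}{\alpha_0-2/3}.$$ Then $J$ is differentiable, the estimation errors $\epsilon_t=v_t-\nabla J(\theta_t)$ are square integrable for $0\le t<T$, and for every $1\le t<T$ $$\mathbb E\|\epsilon_t\|^2\le(1-\alpha_t)\,\mathbb E\|\epsilon_{t-1}\|^2+8\sigma_B^2\eta_{t-1}^2+2\alpha_t^2\sigma_g^2,$$ $$\mathbb E\|\epsilon_t\|^2\le(1-\alpha_t)\,\mathbb E\|\epsilon_{t-1}\|^2+\frac{C_Z}{\eta_0^2}\,\eta_t^2,$$ $$\mathbb E\|\epsilon_t\|^2\le\frac{C_Z'}{t^{2/3}}.$$ In particular, the variance satisfies $\mathbb E\|\epsilon_t-\mathbb E\,\epsilon_t\|^2\le C_Z'/t^{2/3}$. -/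

import Mathlib

open MeasureTheory ProbabilityTheory

noncomputable section

namespace Sharp

/-- The parameter space `ℝ^d` with its Euclidean norm. -/
abbrev Param (d : ℕ) : Type := EuclideanSpace ℝ (Fin d)

/-- A trajectory `(s_0, a_0, …, s_{H-1}, a_{H-1})`. -/
abbrev Traj (S A : Type*) (H : ℕ) : Type _ := Fin H → S × A

/-- A discounted Markov decision process on measurable state and action spaces. -/
structure MDP (S A : Type*) [MeasurableSpace S] [MeasurableSpace A] where
  /-- transition probabilities `P(· | s, a)` -/
  P : Kernel (S × A) S
  isMarkov_P : IsMarkovKernel P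
  /-- distribution of the starting state -/
  ρ : Measure S
  isProb_ρ : IsProbabilityMeasure ρ
  /-- reward function `r(s, a)` -/
  r : S → A → ℝ
  measurable_r : Measurable (Function.uncurry r)
  /-- discount factor -/
  γ : ℝ
  γ_pos : 0 < γ
  γ_lt_one : γ < 1

/-- A family of stochastic policies `π_θ(a | s)`, `θ ∈ ℝ^d`, given by positive probability
densities with respect to a fixed σ-finite measure on the action space (the counting measure when
actions are discrete, Lebesgue measure when they are continuous). -/
structure PolicyFamily (S A : Type*) [MeasurableSpace S] [MeasurableSpace A] (d : ℕ) where
  /-- reference measure on actions -/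
  ν : Measure A
  sigmaFinite_ν : SigmaFinite ν
  /-- `dens θ s a` is `π_θ(a | s)` -/
  dens : Param d → S → A → ℝ
  dens_pos : ∀ θ s a, 0 < dens θ s a
  measurable_dens : ∀ θ, Measurable (Function.uncurry (dens θ))
  lintegral_dens : ∀ θ s, ∫⁻ a, ENNReal.ofReal (dens θ s a) ∂ν = 1

attribute [instance] MDP.isMarkov_P MDP.isProb_ρ PolicyFamily.sigmaFinite_ν

variable {S A : Type*} [MeasurableSpace S] [MeasurableSpace A] {d : ℕ}

/-- Bounded reward: `|r(s, a)| < R₀` for all `s, a`. -/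
def MDP.BoundedReward (M : MDP S A) (R₀ : ℝ) : Prop :=
  ∀ s a, |M.r s a| < R₀

/-- `log π_θ(a | s)` as a function of `θ`. -/
def PolicyFamily.logDens (p : PolicyFamily S A d) (s : S) (a : A) (θ : Param d) : ℝ :=
  Real.log (p.dens θ s a)

/-- Parameterization regularity: `θ ↦ log π_θ(a | s)` is twice differentiable, with
`‖∇ log π_θ(a | s)‖ ≤ G` and `‖∇² log π_θ(a | s)‖ ≤ L` (operator norm). -/
structure PolicyFamily.Regular (p : PolicyFamily S A d) (G L : ℝ) : Prop where
  differentiable_log : ∀ s a, Differentiable ℝ (p.logDens s a)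
  differentiable_grad : ∀ s a, Differentiable ℝ (gradient (p.logDens s a))
  grad_le : ∀ θ s a, ‖gradient (p.logDens s a) θ‖ ≤ G
  hess_le : ∀ θ s a, ‖fderiv ℝ (gradient (p.logDens s a)) θ‖ ≤ L

/-- The action distribution `π_θ(· | s)` as a Markov kernel from states to actions. -/
def PolicyFamily.kernel (p : PolicyFamily S A d) (θ : Param d) : Kernel S A :=
  (Kernel.const S p.ν).withDensity fun s a => ENNReal.ofReal (p.dens θ s a)

/-- The law of a trajectory of length `H` started at a given state: draw `a ∼ π_θ(· | s)`,
then `s' ∼ P(· | s, a)`, and continue from `s'`. -/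
def trajKernel (M : MDP S A) (p : PolicyFamily S A d) (θ : Param d) :
    (H : ℕ) → Kernel S (Traj S A H)
  | 0 => Kernel.const S (Measure.dirac (fun i => i.elim0))
  | H + 1 =>
      (Kernel.id ×ₖ (p.kernel θ ⊗ₖ (trajKernel M p θ H ∘ₖ M.P))).map
        fun x : S × (A × Traj S A H) => (Fin.cons (x.1, x.2.1) x.2.2 : Traj S A (H + 1))

/-- The distribution `p(τ | π_θ)` of a trajectory of horizon `H` under the policy `π_θ`. -/
def trajLaw (M : MDP S A) (p : PolicyFamily S A d) (H : ℕ) (θ : Param d) :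
    Measure (Traj S A H) :=
  M.ρ.bind (trajKernel M p θ H)

/-- Discounted cumulative reward `R(τ) = ∑_{h<H} γ^h r(s_h, a_h)`. -/
def ret (M : MDP S A) {H : ℕ} (τ : Traj S A H) : ℝ :=
  ∑ h : Fin H, M.γ ^ (h : ℕ) * M.r (τ h).1 (τ h).2

/-- Expected return `J(θ) = E_{τ ∼ π_θ}[R(τ)]`. -/
def J (M : MDP S A) (p : PolicyFamily S A d) (H : ℕ) (θ : Param d) : ℝ :=
  ∫ τ, ret M τ ∂(trajLaw M p H θ)

/-- Reward to go `Ψ_h(τ) = ∑_{t=h}^{H-1} γ^t r(s_t, a_t)`. -/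
def rewardToGo (M : MDP S A) {H : ℕ} (τ : Traj S A H) (h : Fin H) : ℝ :=
  ∑ t ∈ Finset.Ici h, M.γ ^ (t : ℕ) * M.r (τ t).1 (τ t).2

/-- Stochastic gradient `g(τ; θ) = ∑_h Ψ_h(τ) ∇ log π_θ(a_h | s_h)`. -/
def gradEst (M : MDP S A) (p : PolicyFamily S A d) {H : ℕ} (τ : Traj S A H) (θ : Param d) :
    Param d :=
  ∑ h : Fin H, rewardToGo M τ h • gradient (p.logDens (τ h).1 (τ h).2) θ

/-- `Φ(θ; τ) = ∑_h ∑_{t=h}^{H-1} γ^t r(s_t, a_t) log π_θ(a_h | s_h)`. -/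
def Phi (M : MDP S A) (p : PolicyFamily S A d) {H : ℕ} (τ : Traj S A H) (θ : Param d) : ℝ :=
  ∑ h : Fin H, rewardToGo M τ h * p.logDens (τ h).1 (τ h).2 θ

/-- The factor `∏_h π_θ(a_h | s_h)` of the trajectory density `p(τ | π_θ)`, that is, the density
with respect to the reference measure built from `ρ`, `P` and `ν`. The remaining factors do not
depend on `θ`, so they do not contribute to `∇ log p(τ | π_θ)`. -/
def likelihood (p : PolicyFamily S A d) {H : ℕ} (τ : Traj S A H) (θ : Param d) : ℝ :=
  ∏ h : Fin H, p.dens θ (τ h).1 (τ h).2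

/-- Stochastic Hessian `B(τ; θ) = ∇Φ(θ; τ) ∇ log p(τ | π_θ)ᵀ + ∇²Φ(θ; τ)`, as a linear map. -/
def hessEst (M : MDP S A) (p : PolicyFamily S A d) {H : ℕ} (τ : Traj S A H) (θ : Param d) :
    Param d →L[ℝ] Param d :=
  (innerSL ℝ (gradient (fun θ' => Real.log (likelihood p τ θ')) θ)).smulRight
      (gradient (Phi M p τ) θ)
    + fderiv ℝ (gradient (Phi M p τ)) θ

/-- Learning rate: `η_t = η₀ / t^{2/3}` for `t ≥ 1`, and `η₀` at `t = 0`. -/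
def stepSize (η₀ : ℝ) (t : ℕ) : ℝ :=
  if t = 0 then η₀ else η₀ / (t : ℝ) ^ (2 / 3 : ℝ)

/-- Momentum weight: `α_t = α₀ / t^{2/3}` for `t ≥ 1`, and `α₀` at `t = 0`. -/
def momentum (α₀ : ℝ) (t : ℕ) : ℝ :=
  if t = 0 then α₀ else α₀ / (t : ℝ) ^ (2 / 3 : ℝ)

/-- The normalized update `θ + η v / ‖v‖` (with no move when `v = 0`). -/
def normStep (η : ℝ) (θ v : Param d) : Param d :=
  θ + η • (‖v‖⁻¹ • v)

/-- The point `b θ + (1 - b) θ'` on the segment from `θ'` to `θ`. -/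
def mixPoint (b : ℝ) (θ θ' : Param d) : Param d :=
  b • θ + (1 - b) • θ'

/-- The pair `(θ_t, v_t)` computed by the SHARP algorithm from its samples: the trajectories
`τ_0, τ_1, …`, the numbers `b_1, b_2, …` and the trajectories `τ^b_1, τ^b_2, …`
(`b 0` and `τb 0` are not used). -/
def iterates (M : MDP S A) (p : PolicyFamily S A d) {H : ℕ} (α₀ η₀ : ℝ) (θ₀ : Param d)
    (τ : ℕ → Traj S A H) (b : ℕ → ℝ) (τb : ℕ → Traj S A H) : ℕ → Param d × Param d
  | 0 => (θ₀, gradEst M p (τ 0) θ₀)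
  | t + 1 =>
      let prev := iterates M p α₀ η₀ θ₀ τ b τb t
      let θ := normStep (stepSize η₀ t) prev.1 prev.2
      (θ, (1 - momentum α₀ (t + 1)) •
            (prev.2 + hessEst M p (τb (t + 1)) (mixPoint (b (t + 1)) θ prev.1) (θ - prev.1))
          + momentum α₀ (t + 1) • gradEst M p (τ (t + 1)) θ)

variable {Ω : Type*}

/-- The random parameter `θ_t`. -/
def paramAt (M : MDP S A) (p : PolicyFamily S A d) {H : ℕ} (α₀ η₀ : ℝ) (θ₀ : Param d)
    (τ : ℕ → Ω → Traj S A H) (b : ℕ → Ω → ℝ) (τb : ℕ → Ω → Traj S A H) (t : ℕ) (ω : Ω) :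
    Param d :=
  (iterates M p α₀ η₀ θ₀ (fun i => τ i ω) (fun i => b i ω) (fun i => τb i ω) t).1

/-- The random gradient estimate `v_t`. -/
def estAt (M : MDP S A) (p : PolicyFamily S A d) {H : ℕ} (α₀ η₀ : ℝ) (θ₀ : Param d)
    (τ : ℕ → Ω → Traj S A H) (b : ℕ → Ω → ℝ) (τb : ℕ → Ω → Traj S A H) (t : ℕ) (ω : Ω) :
    Param d :=
  (iterates M p α₀ η₀ θ₀ (fun i => τ i ω) (fun i => b i ω) (fun i => τb i ω) t).2

/-- The estimation error `ε_t = v_t - ∇J(θ_t)`. -/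
def errAt (M : MDP S A) (p : PolicyFamily S A d) {H : ℕ} (α₀ η₀ : ℝ) (θ₀ : Param d)
    (τ : ℕ → Ω → Traj S A H) (b : ℕ → Ω → ℝ) (τb : ℕ → Ω → Traj S A H) (t : ℕ) (ω : Ω) :
    Param d :=
  estAt M p α₀ η₀ θ₀ τ b τb t ω - gradient (J M p H) (paramAt M p α₀ η₀ θ₀ τ b τb t ω)

/-- The history up to time `t`: the σ-algebra generated by
`τ_0, τ_1, b_1, τ^b_1, …, τ_t, b_t, τ^b_t`. -/
@[reducible] def history {H : ℕ} (τ : ℕ → Ω → Traj S A H) (b : ℕ → Ω → ℝ) (τb : ℕ → Ω → Traj S A H)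
    (t : ℕ) : MeasurableSpace Ω :=
  MeasurableSpace.comap (τ 0) inferInstance ⊔
    ⨆ i ∈ Set.Icc 1 t, MeasurableSpace.comap (fun ω => (τ i ω, b i ω, τb i ω)) inferInstance

/-- The random variables `τ_t`, `b_t`, `τ^b_t` are sampled as in a run of the SHARP algorithm with
`T` iterations: `τ_0` is drawn with the policy `π_{θ_0}`, and for `1 ≤ t < T`
the number `b_t` is uniform on `[0, 1]` and independent of the history up to time `t - 1`, and,
given that history and `b_t`, the trajectories `τ_t` and `τ^b_t` are drawn
independently with the policies `π_{θ_t}` and `π_{θ^b_t}`, where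
`θ^b_t = b_t θ_t + (1 - b_t) θ_{t-1}`. (The time `t` is written `t + 1` below.) -/
structure IsRun [MeasurableSpace Ω] (μ : Measure Ω) (M : MDP S A) (p : PolicyFamily S A d) {H : ℕ}
    (α₀ η₀ : ℝ) (θ₀ : Param d) (T : ℕ)
    (τ : ℕ → Ω → Traj S A H) (b : ℕ → Ω → ℝ) (τb : ℕ → Ω → Traj S A H) : Prop where
  measurable_τ : ∀ t, Measurable (τ t)
  measurable_b : ∀ t, Measurable (b t)
  measurable_τb : ∀ t, Measurable (τb t)
  law_init : μ.map (τ 0) = trajLaw M p H θ₀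
  law_b : ∀ t, t + 1 < T → μ.map (b (t + 1)) = volume.restrict (Set.Icc (0 : ℝ) 1)
  indep_b : ∀ t, t + 1 < T →
    Indep (MeasurableSpace.comap (b (t + 1)) inferInstance) (history τ b τb t) μ
  law_traj : ∀ t, t + 1 < T → ∀ U V : Set (Traj S A H), MeasurableSet U → MeasurableSet V →
    μ[({ω | τ (t + 1) ω ∈ U ∧ τb (t + 1) ω ∈ V}).indicator (fun _ => (1 : ℝ)) |
        history τ b τb t ⊔ MeasurableSpace.comap (b (t + 1)) inferInstance]
      =ᵐ[μ] fun ω =>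
        (trajLaw M p H (paramAt M p α₀ η₀ θ₀ τ b τb (t + 1) ω)).real U *
        (trajLaw M p H (mixPoint (b (t + 1) ω) (paramAt M p α₀ η₀ θ₀ τ b τb (t + 1) ω)
          (paramAt M p α₀ η₀ θ₀ τ b τb t ω))).real V

/-- `σ_g² = G² R₀² / (1 - γ)⁴`. -/
def sigmaGSq (G R₀ γ : ℝ) : ℝ := G ^ 2 * R₀ ^ 2 / (1 - γ) ^ 4

/-- `σ_B² = (H² G⁴ R₀² + L² R₀²) / (1 - γ)⁴`. -/
def sigmaBSq (H : ℕ) (G L R₀ γ : ℝ) : ℝ :=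
  ((H : ℝ) ^ 2 * G ^ 4 * R₀ ^ 2 + L ^ 2 * R₀ ^ 2) / (1 - γ) ^ 4

/-- `C_Z = 8 · 2^{4/3} η₀² σ_B² + 2 α₀² σ_g²`. -/
def constZ (α₀ η₀ σBSq σgSq : ℝ) : ℝ :=
  8 * (2 : ℝ) ^ (4 / 3 : ℝ) * η₀ ^ 2 * σBSq + 2 * α₀ ^ 2 * σgSq

end Sharp

end

/-! Write `U` for the Hessian correction `B(τ^b_t; θ^b_t)(θ_t - θ_{t-1})`, `u = ∇J(θ_t) -
∇J(θ_{t-1})`, `g = g(τ_t; θ_t)` and `q = ∇J(θ_t)`. Then `ε_t = (1 - α_t) ε_{t-1} + (1 - α_t)(U - u)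
+ α_t (g - q)` exactly, and both `U - u` and `g - q` are orthogonal to every bounded function of the
past. So the cross terms with `ε_{t-1}` vanish, and `E‖ε_t‖²` contracts by `(1 - α_t)² ≤ 1 - α_t` up
to the second moments of `U` and `g` (`integral_norm_sq_momentum_step_le`). The normalized update
keeps `U` of size `η_{t-1}`, so this noise is of order `t^{-4/3}`.

Unbiasedness of `g` is the policy gradient theorem `hasGradientAt_J`. For `U`, the matrix `B(τ^b;
θ^b)` has mean `∇²J(θ^b)` (`hasFDerivAt_gradient_J`), and averaging over the uniform point `θ^b` of
the segment turns `∇²J(θ^b)(θ_t - θ_{t-1})` into `u` by the fundamental theorem of calculus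
(`integral_fderiv_segment`). Both derivative formulas are instances of `hasFDerivAt_integral_score`,
applied to the return and to `g`. It is applicable because trajectory laws for different parameters
have an explicit likelihood ratio (`trajLaw_eq_withDensity`). Causality
(`integral_ret_smul_score_sub`) then replaces the full return by the reward to go.

The recursion `x_t ≤ (1 - α₀ t^{-2/3}) x_{t-1} + C_Z t^{-4/3}` propagates `x_t ≤ C / t^{2/3}`
(`decay_step`): passing from `(t-1)^{-2/3}` to `t^{-2/3}` costs at most a fraction `2/3` of `C
t^{-4/3}`, the contraction gains a fraction `α₀`, and the surplus `α₀ - 2/3` pays for the noise when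
`C = C_Z / (α₀ - 2/3)`. -/

noncomputable section

namespace Sharp

/-! ### Differentiation of expectations in the parameter, and integration along segments. -/

section Analysis

variable {X : Type*} [MeasurableSpace X] {d : ℕ}
  {F : Type*} [NormedAddCommGroup F] [NormedSpace ℝ F] [MeasurableSpace F] [BorelSpace F]
  [FiniteDimensional ℝ F]

/-- The derivative in the parameter of a jointly measurable function is jointly measurable. -/
theorem measurable_fderiv_uncurry {f : X → Param d → F} (hf : Measurable (Function.uncurry f))
    (hd : ∀ x, Differentiable ℝ (f x)) :
    Measurable fun z : X × Param d => fderiv ℝ (f z.1) z.2 := by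
  have : SecondCountableTopology F := by
    have := FiniteDimensional.proper_real F
    infer_instance
  -- Each directional derivative is a pointwise limit of the measurable difference quotients with
  -- step `1/n`.
  have key : ∀ v : Param d, Measurable fun z : X × Param d => fderiv ℝ (f z.1) z.2 v := by
    intro v
    refine measurable_of_tendsto_metrizable
      (f := fun (n : ℕ) (z : X × Param d) => (n : ℝ) • (f z.1 (z.2 + (n : ℝ)⁻¹ • v) - f z.1 z.2))
      (fun n => ?_) ?_
    · refine Measurable.const_smul (Measurable.sub ?_ hf) _
      exact hf.comp (measurable_fst.prodMk (measurable_snd.add_const _))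
    · rw [tendsto_pi_nhds]
      intro z
      refine ((hd z.1) z.2).hasFDerivAt.lim v (c := fun n : ℕ => (n : ℝ)) ?_
      simpa using tendsto_natCast_atTop_atTop (R := ℝ)
  -- A linear map on a finite-dimensional space is rebuilt continuously from its values on a basis,
  -- so directional measurability suffices.
  have expand : ∀ T : Param d →L[ℝ] F,
      T = ∑ i, ((EuclideanSpace.proj i : Param d →L[ℝ] ℝ).smulRight
        (T (EuclideanSpace.single i 1))) := by
    intro T
    ext v
    have hv : v = ∑ i, v i • EuclideanSpace.single i (1 : ℝ) := by
      ext j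
      simp [Finset.sum_apply, Pi.single_apply]
    conv_lhs => rw [hv]
    simp [map_sum]
  have hrw : (fun z : X × Param d => fderiv ℝ (f z.1) z.2) = fun z =>
      ∑ i, ((EuclideanSpace.proj i : Param d →L[ℝ] ℝ).smulRight
        (fderiv ℝ (f z.1) z.2 (EuclideanSpace.single i 1))) := funext fun z => expand _
  rw [hrw]
  refine Finset.measurable_fun_sum _ fun i _ => ?_
  exact (ContinuousLinearMap.smulRightL ℝ (Param d) F
    (EuclideanSpace.proj i : Param d →L[ℝ] ℝ)).continuous.measurable.comp (key _)

/-- The gradient in the parameter of a jointly measurable function is jointly measurable. -/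
theorem measurable_gradient_uncurry {f : X → Param d → ℝ} (hf : Measurable (Function.uncurry f))
    (hd : ∀ x, Differentiable ℝ (f x)) :
    Measurable fun z : X × Param d => gradient (f z.1) z.2 :=
  (InnerProductSpace.toDual ℝ (Param d)).symm.continuous.measurable.comp
    (measurable_fderiv_uncurry hf hd)

theorem norm_gradient_eq {E : Type*} [NormedAddCommGroup E] [InnerProductSpace ℝ E]
    [CompleteSpace E] (f : E → ℝ) (x : E) : ‖gradient f x‖ = ‖fderiv ℝ f x‖ := by
  simp [gradient]

/-- Likelihood-ratio formula for the derivative of an expectation whose integrand and whose law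
both depend on the parameter. -/
theorem hasFDerivAt_integral_score {m : Param d → Measure X} [∀ θ, IsProbabilityMeasure (m θ)]
    {l : X → Param d → ℝ} {f : X → Param d → F} {K C C' : ℝ}
    (hm : ∀ θ θ', m θ' = (m θ).withDensity fun x => ENNReal.ofReal (Real.exp (l x θ' - l x θ)))
    (hl : Measurable (Function.uncurry l)) (hf : Measurable (Function.uncurry f))
    (hld : ∀ x, Differentiable ℝ (l x)) (hfd : ∀ x, Differentiable ℝ (f x))
    (hK : ∀ x θ, ‖fderiv ℝ (l x) θ‖ ≤ K) (hC : ∀ x θ, ‖f x θ‖ ≤ C)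
    (hC' : ∀ x θ, ‖fderiv ℝ (f x) θ‖ ≤ C') (θ : Param d) :
    HasFDerivAt (fun θ' => ∫ x, f x θ' ∂m θ')
      (∫ x, (fderiv ℝ (f x) θ + (fderiv ℝ (l x) θ).smulRight (f x θ)) ∂m θ) θ := by
  have : SecondCountableTopology F := by
    have := FiniteDimensional.proper_real F
    infer_instance
  have hsec : ∀ θ', Measurable fun x => l x θ' := fun θ' =>
    hl.comp (measurable_id.prodMk measurable_const)
  have fsec : ∀ θ', Measurable fun x => f x θ' := fun θ' =>
    hf.comp (measurable_id.prodMk measurable_const)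
  have hw : ∀ θ', Measurable fun x => Real.exp (l x θ' - l x θ) := fun θ' =>
    Real.measurable_exp.comp ((hsec θ').sub (hsec θ))
  -- Reweighting to the fixed law `m θ` moves all dependence on `θ'` into the integrand, so
  -- dominated differentiation applies.
  have hchange : (fun θ' => ∫ x, f x θ' ∂m θ') =
      fun θ' => ∫ x, Real.exp (l x θ' - l x θ) • f x θ' ∂m θ := by
    funext θ'
    rw [hm θ θ', integral_withDensity_eq_integral_toReal_smul (hw θ').ennreal_ofReal
      (ae_of_all _ fun x => ENNReal.ofReal_lt_top)]
    refine integral_congr_ae (ae_of_all _ fun x => ?_)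
    simp only
    rw [ENNReal.toReal_ofReal (Real.exp_pos _).le]
  -- On the unit ball the mean value inequality bounds the log-ratio by `K`; this yields the
  -- dominating constant `exp K * (C' + K * C)`.
  have hlip : ∀ x, ∀ θ' ∈ Metric.ball θ 1, l x θ' - l x θ ≤ K := by
    intro x θ' hθ'
    have h1 := convex_univ.norm_image_sub_le_of_norm_fderiv_le (𝕜 := ℝ) (f := l x) (C := K)
      (fun y _ => hld x y) (fun y _ => hK x y) (Set.mem_univ θ) (Set.mem_univ θ')
    have hK0 : 0 ≤ K := (norm_nonneg _).trans (hK x θ)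
    have h2 : ‖θ' - θ‖ ≤ 1 := by
      rw [← dist_eq_norm]; exact (Metric.mem_ball.1 hθ').le
    calc l x θ' - l x θ ≤ ‖l x θ' - l x θ‖ := Real.le_norm_self _
      _ ≤ K * ‖θ' - θ‖ := h1
      _ ≤ K := by nlinarith
  let F' : Param d → X → Param d →L[ℝ] F := fun θ' x =>
    Real.exp (l x θ' - l x θ) •
      (fderiv ℝ (f x) θ' + (fderiv ℝ (l x) θ').smulRight (f x θ'))
  have hF'θ : F' θ = fun x => fderiv ℝ (f x) θ + (fderiv ℝ (l x) θ).smulRight (f x θ) := by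
    funext x; simp [F']
  rw [hchange, ← hF'θ]
  refine hasFDerivAt_integral_of_dominated_of_fderiv_le
    (bound := fun _ => Real.exp K * (C' + K * C)) (F' := F') (Metric.ball_mem_nhds θ one_pos)
    ?_ ?_ ?_ ?_ (integrable_const _) ?_
  · exact Filter.Eventually.of_forall fun θ' =>
      ((hw θ').smul (fsec θ')).aestronglyMeasurable
  · refine Integrable.of_bound ((hw θ).smul (fsec θ)).aestronglyMeasurable C (ae_of_all _ ?_)
    intro x
    simpa using hC x θ
  · rw [hF'θ]
    have h1 : Measurable fun x => fderiv ℝ (f x) θ :=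
      (measurable_fderiv_uncurry hf hfd).comp (measurable_id.prodMk measurable_const)
    have h2 : Measurable fun x => fderiv ℝ (l x) θ :=
      (measurable_fderiv_uncurry hl hld).comp (measurable_id.prodMk measurable_const)
    refine h1.aestronglyMeasurable.add ?_
    have hc : Continuous fun q : (Param d →L[ℝ] ℝ) × F => q.1.smulRight q.2 :=
      (ContinuousLinearMap.smulRightL ℝ (Param d) F).continuous₂
    exact (hc.measurable.comp (h2.prodMk (fsec θ))).aestronglyMeasurable
  · refine ae_of_all _ fun x θ' hθ' => ?_
    have hK0 : 0 ≤ K := (norm_nonneg _).trans (hK x θ)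
    have hC0 : 0 ≤ C := (norm_nonneg _).trans (hC x θ)
    simp only [F']
    rw [norm_smul, Real.norm_eq_abs, Real.abs_exp]
    refine mul_le_mul (Real.exp_le_exp.2 (hlip x θ' hθ')) ?_ (norm_nonneg _) (Real.exp_pos _).le
    refine (norm_add_le _ _).trans (add_le_add (hC' x θ') ?_)
    rw [ContinuousLinearMap.norm_smulRight_apply]
    exact mul_le_mul (hK x θ') (hC x θ') (norm_nonneg _) hK0
  · refine ae_of_all _ fun x θ' _ => ?_
    have h1 := (((hld x) θ').hasFDerivAt.sub_const (l x θ)).exp.smul ((hfd x) θ').hasFDerivAt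
    refine h1.congr_fderiv ?_
    ext v
    simp [F', smul_smul]

/-- A function that is everywhere differentiable with bounded derivative is the integral of its
derivative along segments. -/
theorem integral_fderiv_segment {f : Param d → F} (hf : Differentiable ℝ f) {C : ℝ}
    (hC : ∀ θ, ‖fderiv ℝ f θ‖ ≤ C) (θ θ' : Param d) :
    ∫ s in Set.Icc (0 : ℝ) 1, fderiv ℝ f (mixPoint s θ θ') (θ - θ') = f θ - f θ' := by
  have : SecondCountableTopology F := by
    have := FiniteDimensional.proper_real F
    infer_instance
  have : CompleteSpace F := FiniteDimensional.complete ℝ F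
  have hline : ∀ s : ℝ, HasDerivAt (fun s : ℝ => mixPoint s θ θ') (θ - θ') s := by
    intro s
    have h := ((hasDerivAt_id s).smul_const θ).add
      (((hasDerivAt_id s).const_sub 1).smul_const θ')
    exact h.congr_deriv (by simp [sub_eq_add_neg])
  have hder : ∀ s : ℝ, HasDerivAt (fun s : ℝ => f (mixPoint s θ θ'))
      (fderiv ℝ f (mixPoint s θ θ') (θ - θ')) s := fun s =>
    (hf _).hasFDerivAt.comp_hasDerivAt s (hline s)
  -- The derivative of `f` need not be continuous. Along the line it is the derivative of a function
  -- of one real variable, hence measurable, and boundedness then gives the integrability that the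
  -- fundamental theorem needs.
  have hmeas : Measurable fun s : ℝ => fderiv ℝ f (mixPoint s θ θ') (θ - θ') := by
    have : (fun s : ℝ => fderiv ℝ f (mixPoint s θ θ') (θ - θ')) =
        deriv (fun s : ℝ => f (mixPoint s θ θ')) := funext fun s => (hder s).deriv.symm
    rw [this]
    exact measurable_deriv _
  have hint : IntervalIntegrable (fun s : ℝ => fderiv ℝ f (mixPoint s θ θ') (θ - θ'))
      volume 0 1 := by
    rw [intervalIntegrable_iff_integrableOn_Ioc_of_le zero_le_one]
    refine Integrable.of_bound hmeas.aestronglyMeasurable (C * ‖θ - θ'‖) (ae_of_all _ fun s => ?_)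
    exact (ContinuousLinearMap.le_opNorm _ _).trans
      (mul_le_mul_of_nonneg_right (hC _) (norm_nonneg _))
  have h := intervalIntegral.integral_eq_sub_of_hasDerivAt (fun s _ => hder s) hint
  rw [integral_Icc_eq_integral_Ioc, ← intervalIntegral.integral_of_le zero_le_one, h]
  simp [mixPoint]

end Analysis

/-! ### From conditional probabilities to joint laws. -/

section Disintegration

variable {Ω 𝒳 Y : Type*} {m m₀ : MeasurableSpace Ω} [MeasurableSpace 𝒳] [MeasurableSpace Y]
  {μ : Measure Ω} [IsProbabilityMeasure μ]

/-- If the conditional probabilities of `y` given `m` are those of a kernel evaluated at an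
`m`-measurable `x`, then the joint law of `(x, y)` is the composition-product. -/
theorem map_prodMk_eq_compProd_of_condExp (hm : m ≤ m₀) {x : Ω → 𝒳} {y : Ω → Y}
    (hx : Measurable[m] x) (hy : Measurable y) (κ : Kernel 𝒳 Y) [IsMarkovKernel κ]
    (h : ∀ U, MeasurableSet U →
      μ[(y ⁻¹' U).indicator (fun _ => (1 : ℝ)) | m] =ᵐ[μ] fun ω => (κ (x ω)).real U) :
    μ.map (fun ω => (x ω, y ω)) = μ.map x ⊗ₘ κ := by
  have hx' : Measurable x := hx.mono hm le_rfl
  have : IsProbabilityMeasure (μ.map x) := Measure.isProbabilityMeasure_map hx'.aemeasurable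
  have : IsProbabilityMeasure (μ.map fun ω => (x ω, y ω)) :=
    Measure.isProbabilityMeasure_map (hx'.prodMk hy).aemeasurable
  refine Measure.ext_prod fun {D U} hD hU => ?_
  rw [Measure.map_apply (hx'.prodMk hy) (hD.prod hU), Measure.compProd_apply_prod hD hU,
    setLIntegral_map hD (κ.measurable_coe hU) hx']
  -- Since `x ⁻¹' D` is an event of `m`, integrating the conditional expectation over it gives the
  -- mass of the rectangle `D ×ˢ U`.
  have hDm : MeasurableSet[m] (x ⁻¹' D) := hx hD
  have hint : Integrable ((y ⁻¹' U).indicator fun _ => (1 : ℝ)) μ :=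
    (integrable_const _).indicator (hy hU)
  have h1 := setIntegral_condExp hm hint hDm
  rw [setIntegral_congr_ae (g := fun ω => (κ (x ω)).real U) (hm _ hDm)
    ((h U hU).mono fun ω hω _ => hω)] at h1
  rw [setIntegral_indicator (hy hU)] at h1
  simp only [integral_const, MeasurableSet.univ, measureReal_restrict_apply, Set.univ_inter,
    smul_eq_mul, mul_one] at h1
  have hmk : Measurable fun ω => κ (x ω) U := (κ.measurable_coe hU).comp hx'
  have h2 : ∫ ω in x ⁻¹' D, (κ (x ω)).real U ∂μ
      = (∫⁻ ω in x ⁻¹' D, κ (x ω) U ∂μ).toReal :=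
    integral_toReal hmk.aemeasurable (ae_of_all _ fun ω => measure_lt_top _ _)
  rw [h2] at h1
  have h3 : ∫⁻ ω in x ⁻¹' D, κ (x ω) U ∂μ ≠ ⊤ := by
    refine ne_top_of_le_ne_top (b := μ (x ⁻¹' D)) (measure_ne_top _ _) ?_
    calc ∫⁻ ω in x ⁻¹' D, κ (x ω) U ∂μ ≤ ∫⁻ _ in x ⁻¹' D, 1 ∂μ :=
          lintegral_mono fun ω => prob_le_one
      _ = μ (x ⁻¹' D) := by simp
  rw [show (fun ω => (x ω, y ω)) ⁻¹' D ×ˢ U = x ⁻¹' D ∩ y ⁻¹' U from rfl]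
  exact ((ENNReal.toReal_eq_toReal_iff' h3 (measure_ne_top _ _)).1 h1).symm

/-- Expectation of a bounded function of `(x, y)`, computed by first averaging over `y`. -/
theorem integral_comp_prodMk_of_condExp (hm : m ≤ m₀) {x : Ω → 𝒳} {y : Ω → Y}
    (hx : Measurable[m] x) (hy : Measurable y) (κ : Kernel 𝒳 Y) [IsMarkovKernel κ]
    (h : ∀ U, MeasurableSet U →
      μ[(y ⁻¹' U).indicator (fun _ => (1 : ℝ)) | m] =ᵐ[μ] fun ω => (κ (x ω)).real U)
    {f : 𝒳 × Y → ℝ} (hf : Measurable f) (hint : Integrable (fun ω => f (x ω, y ω)) μ) :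
    ∫ ω, f (x ω, y ω) ∂μ = ∫ ω, ∫ u, f (x ω, u) ∂κ (x ω) ∂μ := by
  have hx' : Measurable x := hx.mono hm le_rfl
  have hmap := map_prodMk_eq_compProd_of_condExp hm hx hy κ h
  have : IsProbabilityMeasure (μ.map x) := Measure.isProbabilityMeasure_map hx'.aemeasurable
  have h1 : ∫ ω, f (x ω, y ω) ∂μ = ∫ z, f z ∂(μ.map fun ω => (x ω, y ω)) :=
    (integral_map (hx'.prodMk hy).aemeasurable hf.aestronglyMeasurable).symm
  have h2 : Integrable f (μ.map fun ω => (x ω, y ω)) :=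
    (integrable_map_measure hf.aestronglyMeasurable (hx'.prodMk hy).aemeasurable).2 hint
  rw [hmap] at h2
  rw [h1, hmap, Measure.integral_compProd h2]
  refine integral_map hx'.aemeasurable ?_
  exact (hf.stronglyMeasurable.integral_kernel_prod_right' (κ := κ)).aestronglyMeasurable

end Disintegration

/-! ### Step sizes and the scalar recursion. -/

section Numeric

theorem momentum_nonneg {α₀ : ℝ} (h : 0 ≤ α₀) (t : ℕ) : 0 ≤ momentum α₀ t := by
  unfold momentum; split_ifs <;> positivity

theorem momentum_le_one {α₀ : ℝ} (h0 : 0 ≤ α₀) (h : α₀ ≤ 1) (t : ℕ) : momentum α₀ t ≤ 1 := by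
  unfold momentum
  split_ifs with ht
  · exact h
  · refine (div_le_self h0 ?_).trans h
    exact Real.one_le_rpow (by exact_mod_cast Nat.one_le_iff_ne_zero.2 ht) (by norm_num)

theorem stepSize_nonneg {η₀ : ℝ} (h : 0 ≤ η₀) (t : ℕ) : 0 ≤ stepSize η₀ t := by
  unfold stepSize; split_ifs <;> positivity

theorem rpow_two_thirds_sq {x : ℝ} (hx : 0 ≤ x) :
    (x ^ (2 / 3 : ℝ)) ^ 2 = x ^ (4 / 3 : ℝ) := by
  rw [← Real.rpow_natCast, ← Real.rpow_mul hx]; norm_num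

/-- The ratio `(t + 1) / t` is at most `2`, which is the origin of `2^{4/3}` in `constZ`. At `t = 0`
the convention `stepSize η₀ 0 = η₀` makes both step sizes equal. -/
theorem stepSize_pred_sq_le {η₀ : ℝ} (t : ℕ) :
    stepSize η₀ t ^ 2 ≤ (2 : ℝ) ^ (4 / 3 : ℝ) * stepSize η₀ (t + 1) ^ 2 := by
  rcases Nat.eq_zero_or_pos t with rfl | ht
  · simp only [stepSize, if_true, zero_add, one_ne_zero, if_false, Nat.cast_one, Real.one_rpow,
      div_one]
    have : (1 : ℝ) ≤ 2 ^ (4 / 3 : ℝ) := Real.one_le_rpow (by norm_num) (by norm_num)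
    nlinarith [sq_nonneg η₀]
  · have ht' : (0 : ℝ) < t := by exact_mod_cast ht
    have ht1 : (1 : ℝ) ≤ t := by exact_mod_cast ht
    simp only [stepSize, ht.ne', if_false, Nat.succ_ne_zero, div_pow, Nat.cast_add, Nat.cast_one]
    rw [rpow_two_thirds_sq ht'.le, rpow_two_thirds_sq (by positivity), ← mul_div_assoc,
      div_le_div_iff₀ (by positivity) (by positivity)]
    have : ((t : ℝ) + 1) ^ (4 / 3 : ℝ) ≤ 2 ^ (4 / 3 : ℝ) * (t : ℝ) ^ (4 / 3 : ℝ) := by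
      rw [← Real.mul_rpow (by norm_num) ht'.le]
      exact Real.rpow_le_rpow (by positivity) (by linarith) (by norm_num)
    nlinarith [mul_le_mul_of_nonneg_left this (sq_nonneg η₀)]

/-- The two error terms of the recursion are at most `C_Z η_t² / η₀²`. -/
theorem error_terms_le {α₀ η₀ σB σg : ℝ} (hη : 0 < η₀) (hσB : 0 ≤ σB) (t : ℕ) :
    8 * σB * stepSize η₀ t ^ 2 + 2 * momentum α₀ (t + 1) ^ 2 * σg
      ≤ constZ α₀ η₀ σB σg / η₀ ^ 2 * stepSize η₀ (t + 1) ^ 2 := by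
  have h1 := mul_le_mul_of_nonneg_left (stepSize_pred_sq_le (η₀ := η₀) t)
    (by positivity : 0 ≤ 8 * σB)
  have h2 : momentum α₀ (t + 1) ^ 2 = α₀ ^ 2 / η₀ ^ 2 * stepSize η₀ (t + 1) ^ 2 := by
    simp only [momentum, stepSize, Nat.succ_ne_zero, if_false]
    field_simp
  rw [h2]
  have h3 : constZ α₀ η₀ σB σg / η₀ ^ 2 * stepSize η₀ (t + 1) ^ 2
      = 8 * σB * ((2 : ℝ) ^ (4 / 3 : ℝ) * stepSize η₀ (t + 1) ^ 2)
        + 2 * (α₀ ^ 2 / η₀ ^ 2 * stepSize η₀ (t + 1) ^ 2) * σg := by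
    unfold constZ; field_simp
  rw [h3]
  linarith

/-- One step of the induction for the decay `C' / t^{2/3}`. -/
theorem decay_step {α₀ C : ℝ} (hα : 2 / 3 < α₀) (hC : 0 ≤ C) {t : ℕ} (ht : 1 ≤ t) :
    (1 - α₀ / ((t + 1 : ℕ) : ℝ) ^ (2 / 3 : ℝ)) * (C / (t : ℝ) ^ (2 / 3 : ℝ))
        + C * (α₀ - 2 / 3) / (((t + 1 : ℕ) : ℝ) ^ (2 / 3 : ℝ)) ^ 2
      ≤ C / ((t + 1 : ℕ) : ℝ) ^ (2 / 3 : ℝ) := by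
  have ht0 : (0 : ℝ) < t := by exact_mod_cast ht
  have ht1 : (1 : ℝ) ≤ t := by exact_mod_cast ht
  -- Bernoulli's inequality for the exponent `2/3`, used twice: here on `1 + 1/t` to control the
  -- increment of `t^{2/3}`, and in `hx1` on `1 + t` to compare `(t + 1)^{2/3}` with `t`.
  have hb : ((t + 1 : ℕ) : ℝ) ^ (2 / 3 : ℝ)
      ≤ (t : ℝ) ^ (2 / 3 : ℝ) * (1 + 2 / 3 * (1 / (t : ℝ))) := by
    have h1 : ((t + 1 : ℕ) : ℝ) = t * (1 + 1 / t) := by push_cast; field_simp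
    rw [h1, Real.mul_rpow ht0.le (by positivity)]
    refine mul_le_mul_of_nonneg_left ?_ (by positivity)
    exact rpow_one_add_le_one_add_mul_self (le_trans (by norm_num) (by positivity : (0:ℝ) ≤ 1 / t))
      (by norm_num) (by norm_num)
  have hx1 : ((t + 1 : ℕ) : ℝ) ^ (2 / 3 : ℝ) ≤ 1 + 2 / 3 * (t : ℝ) := by
    push_cast
    rw [add_comm]
    exact rpow_one_add_le_one_add_mul_self (by linarith) (by norm_num) (by norm_num)
  have hyx : (t : ℝ) ^ (2 / 3 : ℝ) ≤ ((t + 1 : ℕ) : ℝ) ^ (2 / 3 : ℝ) :=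
    Real.rpow_le_rpow ht0.le (by push_cast; linarith) (by norm_num)
  have hxone : 1 ≤ ((t + 1 : ℕ) : ℝ) ^ (2 / 3 : ℝ) :=
    Real.one_le_rpow (by push_cast; linarith) (by norm_num)
  have hy : 0 < (t : ℝ) ^ (2 / 3 : ℝ) := by positivity
  generalize ((t + 1 : ℕ) : ℝ) ^ (2 / 3 : ℝ) = x at *
  generalize (t : ℝ) ^ (2 / 3 : ℝ) = y at *
  have hx : 0 < x := by linarith
  have hxy : (x - y) * (3 * t) ≤ 2 * y := by
    have : y * (1 + 2 / 3 * (1 / (t : ℝ))) = y + 2 * y / (3 * t) := by field_simp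
    rw [this] at hb
    have h4 : x - y ≤ 2 * y / (3 * t) := by linarith
    rwa [le_div_iff₀ (by positivity)] at h4
  -- By `hxy` the increment `x - y` is at most `2y / (3t)`. The other factor is at most `1 + 2t/3 -
  -- 2/3 ≤ t`, by `α₀ > 2/3` and `t ≥ 1`.
  have hkey : (x - α₀) * (x - y) ≤ 2 / 3 * y := by
    rcases le_or_gt (x - α₀) 0 with h | h
    · nlinarith
    · have : x - α₀ ≤ t := by linarith
      nlinarith
  have hfin : (1 - α₀ / x) * (1 / y) + (α₀ - 2 / 3) / x ^ 2 ≤ 1 / x := by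
    -- The numerator equals `2/3 * y - (x - α₀) * (x - y)`, which `hkey` makes nonnegative.
    have e : 1 / x - ((1 - α₀ / x) * (1 / y) + (α₀ - 2 / 3) / x ^ 2)
        = (x * y - (x - α₀) * x - (α₀ - 2 / 3) * y) / (x ^ 2 * y) := by
      field_simp
      ring
    have : 0 ≤ (x * y - (x - α₀) * x - (α₀ - 2 / 3) * y) / (x ^ 2 * y) := by
      apply div_nonneg _ (by positivity)
      nlinarith
    linarith
  have := mul_le_mul_of_nonneg_left hfin hC
  calc (1 - α₀ / x) * (C / y) + C * (α₀ - 2 / 3) / x ^ 2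
      = C * ((1 - α₀ / x) * (1 / y) + (α₀ - 2 / 3) / x ^ 2) := by ring
    _ ≤ C * (1 / x) := this
    _ = C / x := by ring

end Numeric


/-! ### Trajectory laws and their likelihood ratios. -/

section TrajectoryLaw

variable {S A : Type*} [MeasurableSpace S] [MeasurableSpace A] {d : ℕ}

/-- The `θ`-dependent part `∑_h log π_θ(a_h | s_h)` of the log-likelihood of a trajectory. -/
def logLik (p : PolicyFamily S A d) {H : ℕ} (τ : Traj S A H) (θ : Param d) : ℝ :=
  ∑ h : Fin H, p.logDens (τ h).1 (τ h).2 θ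

theorem log_likelihood (p : PolicyFamily S A d) {H : ℕ} (τ : Traj S A H) (θ : Param d) :
    Real.log (likelihood p τ θ) = logLik p τ θ :=
  Real.log_prod fun h _ => (p.dens_pos θ (τ h).1 (τ h).2).ne'

theorem logLik_cons (p : PolicyFamily S A d) {H : ℕ} (x : S × A) (τ : Traj S A H) (θ : Param d) :
    logLik p (Fin.cons x τ : Traj S A (H + 1)) θ = p.logDens x.1 x.2 θ + logLik p τ θ := by
  simp [logLik, Fin.sum_univ_succ]

theorem measurable_logDens (p : PolicyFamily S A d) (θ : Param d) :
    Measurable fun x : S × A => p.logDens x.1 x.2 θ :=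
  Real.measurable_log.comp (p.measurable_dens θ)

theorem measurable_logLik (p : PolicyFamily S A d) {H : ℕ} (θ : Param d) :
    Measurable fun τ : Traj S A H => logLik p τ θ :=
  Finset.measurable_fun_sum _ fun h _ => (measurable_logDens p θ).comp (measurable_pi_apply h)

/-- The likelihood ratio of a trajectory for the parameters `θ'` and `θ`. -/
def ratio (p : PolicyFamily S A d) {H : ℕ} (θ θ' : Param d) (τ : Traj S A H) : ENNReal :=
  ENNReal.ofReal (Real.exp (logLik p τ θ' - logLik p τ θ))

theorem measurable_ratio (p : PolicyFamily S A d) {H : ℕ} (θ θ' : Param d) :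
    Measurable (ratio p (H := H) θ θ') :=
  (Real.measurable_exp.comp ((measurable_logLik p θ').sub (measurable_logLik p θ))).ennreal_ofReal

theorem kernel_apply (p : PolicyFamily S A d) (θ : Param d) (s : S) :
    p.kernel θ s = p.ν.withDensity fun a => ENNReal.ofReal (p.dens θ s a) := by
  rw [PolicyFamily.kernel, Kernel.withDensity_apply _ (p.measurable_dens θ).ennreal_ofReal]
  rfl

instance (p : PolicyFamily S A d) (θ : Param d) : IsMarkovKernel (p.kernel θ) := by
  refine ⟨fun s => ⟨?_⟩⟩
  rw [kernel_apply, withDensity_apply _ MeasurableSet.univ, Measure.restrict_univ]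
  exact p.lintegral_dens θ s

theorem measurable_cons {X : Type*} [MeasurableSpace X] {H : ℕ} :
    Measurable fun x : X × (Fin H → X) => (Fin.cons x.1 x.2 : Fin (H + 1) → X) := by
  rw [measurable_pi_iff]
  intro i
  refine Fin.cases ?_ (fun j => ?_) i
  · simpa using measurable_fst
  · simpa using (measurable_snd (α := X) (β := Fin H → X)).eval (a := j)

theorem measurable_consTriple {H : ℕ} :
    Measurable fun x : S × (A × Traj S A H) => (Fin.cons (x.1, x.2.1) x.2.2 : Traj S A (H + 1)) :=
  measurable_cons.comp (f := fun x : S × (A × Traj S A H) => ((x.1, x.2.1), x.2.2))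
    (by fun_prop)

instance (M : MDP S A) (p : PolicyFamily S A d) (θ : Param d) (H : ℕ) :
    IsMarkovKernel (trajKernel M p θ H) := by
  induction H with
  | zero => unfold trajKernel; infer_instance
  | succ H ih =>
    unfold trajKernel
    exact Kernel.IsMarkovKernel.map _ measurable_consTriple

instance (M : MDP S A) (p : PolicyFamily S A d) (θ : Param d) (H : ℕ) :
    IsProbabilityMeasure (trajLaw M p H θ) := by
  unfold trajLaw; infer_instance

theorem trajKernel_succ_apply (M : MDP S A) (p : PolicyFamily S A d) (θ : Param d) (H : ℕ)
    (s : S) :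
    trajKernel M p θ (H + 1) s =
      ((p.kernel θ ⊗ₖ (trajKernel M p θ H ∘ₖ M.P)) s).map
        fun y => (Fin.cons (s, y.1) y.2 : Traj S A (H + 1)) := by
  conv_lhs => unfold trajKernel
  rw [Kernel.map_apply _ measurable_consTriple, Kernel.prod_apply, Kernel.id_apply,
    Measure.dirac_prod, Measure.map_map measurable_consTriple measurable_prodMk_left]
  rfl

theorem measurable_consPair {H : ℕ} (s : S) :
    Measurable fun y : A × Traj S A H => (Fin.cons (s, y.1) y.2 : Traj S A (H + 1)) :=
  measurable_consTriple.comp measurable_prodMk_left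

theorem lintegral_trajKernel_succ (M : MDP S A) (p : PolicyFamily S A d) (θ : Param d) (H : ℕ)
    (s : S) {f : Traj S A (H + 1) → ENNReal} (hf : Measurable f) :
    ∫⁻ τ, f τ ∂trajKernel M p θ (H + 1) s =
      ∫⁻ a, ∫⁻ s', ∫⁻ τ, f (Fin.cons (s, a) τ : Traj S A (H + 1)) ∂trajKernel M p θ H s'
        ∂M.P (s, a) ∂p.kernel θ s := by
  have hf' : Measurable fun y : A × Traj S A H => f (Fin.cons (s, y.1) y.2 : Traj S A (H + 1)) :=
    hf.comp (measurable_consPair s)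
  rw [trajKernel_succ_apply, lintegral_map hf (measurable_consPair s),
    Kernel.lintegral_compProd _ _ _ hf']
  refine lintegral_congr fun a => ?_
  exact Kernel.lintegral_comp _ _ _ (hf'.comp measurable_prodMk_left)

theorem integral_trajKernel_succ (M : MDP S A) (p : PolicyFamily S A d) (θ : Param d) (H : ℕ)
    (s : S) {F : Type*} [NormedAddCommGroup F] [NormedSpace ℝ F] {f : Traj S A (H + 1) → F}
    (hf : StronglyMeasurable f) {C : ℝ} (hC : ∀ τ, ‖f τ‖ ≤ C) :
    ∫ τ, f τ ∂trajKernel M p θ (H + 1) s =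
      ∫ a, ∫ s', ∫ τ, f (Fin.cons (s, a) τ : Traj S A (H + 1)) ∂trajKernel M p θ H s'
        ∂M.P (s, a) ∂p.kernel θ s := by
  have hf' : StronglyMeasurable fun y : A × Traj S A H =>
      f (Fin.cons (s, y.1) y.2 : Traj S A (H + 1)) :=
    hf.comp_measurable (measurable_consPair s)
  rw [trajKernel_succ_apply, integral_map (measurable_consPair s).aemeasurable
    hf.aestronglyMeasurable, ProbabilityTheory.integral_compProd
      (Integrable.of_bound hf'.aestronglyMeasurable C (ae_of_all _ fun _ => hC _))]
  refine integral_congr_ae (ae_of_all _ fun a => ?_)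
  exact Kernel.integral_comp (Integrable.of_bound
    (hf'.comp_measurable measurable_prodMk_left).aestronglyMeasurable C
      (ae_of_all _ fun _ => hC _))

/-- Positivity of the densities makes the policies mutually absolutely continuous, with ratio the
exponential of the difference of log-densities. -/
theorem lintegral_kernel_eq (p : PolicyFamily S A d) (θ θ' : Param d) (s : S) {f : A → ENNReal}
    (hf : Measurable f) :
    ∫⁻ a, f a ∂p.kernel θ' s =
      ∫⁻ a, ENNReal.ofReal (Real.exp (p.logDens s a θ' - p.logDens s a θ)) * f a
        ∂p.kernel θ s := by
  have hd : ∀ θ, Measurable fun a => ENNReal.ofReal (p.dens θ s a) := fun θ =>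
    ((p.measurable_dens θ).comp measurable_prodMk_left).ennreal_ofReal
  have hl : ∀ θ, Measurable fun a => p.logDens s a θ := fun θ =>
    (measurable_logDens p θ).comp measurable_prodMk_left
  have hr : Measurable fun a =>
      ENNReal.ofReal (Real.exp (p.logDens s a θ' - p.logDens s a θ)) :=
    (Real.measurable_exp.comp ((hl θ').sub (hl θ))).ennreal_ofReal
  rw [kernel_apply, kernel_apply, lintegral_withDensity_eq_lintegral_mul _ (hd θ') hf,
    show (fun a => ENNReal.ofReal (Real.exp (p.logDens s a θ' - p.logDens s a θ)) * f a) =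
      (fun a => ENNReal.ofReal (Real.exp (p.logDens s a θ' - p.logDens s a θ))) * f from rfl,
    lintegral_withDensity_eq_lintegral_mul _ (hd θ) (hr.mul hf)]
  refine lintegral_congr fun a => ?_
  simp only [Pi.mul_apply]
  rw [← mul_assoc, ← ENNReal.ofReal_mul (p.dens_pos θ s a).le]
  congr 2
  rw [Real.exp_sub, PolicyFamily.logDens, PolicyFamily.logDens, Real.exp_log (p.dens_pos _ _ _),
    Real.exp_log (p.dens_pos _ _ _)]
  field_simp [(p.dens_pos θ s a).ne']

/-- Only the action draws depend on the parameter. By induction on the horizon, the tail contributes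
its own ratio, the first action contributes one more factor, and the two multiply because `logLik`
is additive under `Fin.cons`; the transition kernel is the same on both sides. -/
theorem lintegral_trajKernel_eq (M : MDP S A) (p : PolicyFamily S A d) (θ θ' : Param d) (H : ℕ) :
    ∀ (s : S) {f : Traj S A H → ENNReal}, Measurable f →
      ∫⁻ τ, f τ ∂trajKernel M p θ' H s = ∫⁻ τ, ratio p θ θ' τ * f τ ∂trajKernel M p θ H s := by
  induction H with
  | zero =>
    intro s f hf
    simp [trajKernel, ratio, logLik]
  | succ H ih =>
    intro s f hf
    have hcons : ∀ a, Measurable fun τ : Traj S A H =>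
        f (Fin.cons (s, a) τ : Traj S A (H + 1)) := fun a =>
      hf.comp ((measurable_consPair s).comp measurable_prodMk_left)
    have hrf : Measurable fun τ : Traj S A (H + 1) => ratio p θ θ' τ * f τ :=
      (measurable_ratio p θ θ').mul hf
    rw [lintegral_trajKernel_succ M p θ' H s hf,
      lintegral_trajKernel_succ M p θ H s hrf]
    have hw : ∀ a, Measurable fun τ : Traj S A H =>
        ratio p θ θ' τ * f (Fin.cons (s, a) τ : Traj S A (H + 1)) := fun a =>
      (measurable_ratio p θ θ').mul (hcons a)
    have hinner : ∀ a, ∫⁻ s', ∫⁻ τ, f (Fin.cons (s, a) τ : Traj S A (H + 1))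
        ∂trajKernel M p θ' H s' ∂M.P (s, a) =
        ∫⁻ τ, ratio p θ θ' τ * f (Fin.cons (s, a) τ : Traj S A (H + 1))
          ∂(trajKernel M p θ H ∘ₖ M.P) (s, a) := by
      intro a
      rw [Kernel.lintegral_comp _ _ _ (hw a)]
      exact lintegral_congr fun s' => ih s' (hcons a)
    have hmeas : Measurable fun a => ∫⁻ τ, ratio p θ θ' τ * f (Fin.cons (s, a) τ : Traj S A (H + 1))
          ∂(trajKernel M p θ H ∘ₖ M.P) (s, a) := by
      have h1 : Measurable fun y : A × Traj S A H =>
          ratio p θ θ' y.2 * f (Fin.cons (s, y.1) y.2 : Traj S A (H + 1)) :=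
        ((measurable_ratio p θ θ').comp measurable_snd).mul (hf.comp (measurable_consPair s))
      exact Measurable.lintegral_kernel_prod_right'
        (κ := (trajKernel M p θ H ∘ₖ M.P).comap (fun a => (s, a)) measurable_prodMk_left) h1
    rw [lintegral_congr hinner, lintegral_kernel_eq p θ θ' s hmeas]
    refine lintegral_congr fun a => ?_
    rw [Kernel.lintegral_comp _ _ _ (hw a), ← lintegral_const_mul]
    · refine lintegral_congr fun s' => ?_
      rw [← lintegral_const_mul _ (hw a)]
      refine lintegral_congr fun τ => ?_
      rw [← mul_assoc, ratio, ratio, ← ENNReal.ofReal_mul (Real.exp_pos _).le, ← Real.exp_add,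
        logLik_cons, logLik_cons]
      congr 3
      ring
    · exact (hw a).lintegral_kernel (κ := trajKernel M p θ H)

theorem trajKernel_eq_withDensity (M : MDP S A) (p : PolicyFamily S A d) (θ θ' : Param d) (H : ℕ)
    (s : S) :
    trajKernel M p θ' H s = (trajKernel M p θ H s).withDensity fun τ =>
      ENNReal.ofReal (Real.exp (logLik p τ θ' - logLik p τ θ)) := by
  refine Measure.ext_of_lintegral _ fun f hf => ?_
  change _ = ∫⁻ τ, f τ ∂(trajKernel M p θ H s).withDensity (ratio p θ θ')
  rw [lintegral_trajKernel_eq M p θ θ' H s hf,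
    lintegral_withDensity_eq_lintegral_mul _ (measurable_ratio p θ θ') hf]
  rfl

theorem trajLaw_eq_withDensity (M : MDP S A) (p : PolicyFamily S A d) (H : ℕ) (θ θ' : Param d) :
    trajLaw M p H θ' = (trajLaw M p H θ).withDensity fun τ =>
      ENNReal.ofReal (Real.exp (logLik p τ θ' - logLik p τ θ)) := by
  refine Measure.ext_of_lintegral _ fun f hf => ?_
  have hr := (measurable_ratio p (H := H) θ θ')
  change _ = ∫⁻ τ, f τ ∂(trajLaw M p H θ).withDensity (ratio p θ θ')
  rw [lintegral_withDensity_eq_lintegral_mul _ hr hf, trajLaw, trajLaw,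
    Measure.lintegral_bind (Kernel.aemeasurable _) hf.aemeasurable,
    Measure.lintegral_bind (Kernel.aemeasurable _) (hr.mul hf).aemeasurable]
  exact lintegral_congr fun s => lintegral_trajKernel_eq M p θ θ' H s hf

theorem integral_trajLaw (M : MDP S A) (p : PolicyFamily S A d) (H : ℕ) (θ : Param d)
    {F : Type*} [NormedAddCommGroup F] [NormedSpace ℝ F] {f : Traj S A H → F}
    (hf : Integrable f (trajLaw M p H θ)) :
    ∫ τ, f τ ∂trajLaw M p H θ = ∫ s, ∫ τ, f τ ∂trajKernel M p θ H s ∂M.ρ := by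
  have h : trajLaw M p H θ = (trajKernel M p θ H ∘ₖ Kernel.const Unit M.ρ) () := by
    rw [Kernel.comp_apply]; rfl
  rw [h] at hf ⊢
  exact Kernel.integral_comp hf

end TrajectoryLaw


/-! ### Bounds and unbiasedness of the stochastic gradient and Hessian. -/

section Estimators

variable {S A : Type*} [MeasurableSpace S] [MeasurableSpace A] {d : ℕ} {H : ℕ}

section Rewards

theorem measurable_reward (M : MDP S A) (h : Fin H) :
    Measurable fun τ : Traj S A H => M.r (τ h).1 (τ h).2 :=
  M.measurable_r.comp (measurable_pi_apply h)

theorem measurable_ret (M : MDP S A) : Measurable fun τ : Traj S A H => ret M τ :=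
  Finset.measurable_fun_sum _ fun h _ => (measurable_reward M h).const_mul _

theorem measurable_rewardToGo (M : MDP S A) (h : Fin H) :
    Measurable fun τ : Traj S A H => rewardToGo M τ h :=
  Finset.measurable_fun_sum _ fun t _ => (measurable_reward M t).const_mul _

/-- A geometric tail. The factor `γ ^ h` is kept because summing it over `h` yields the second power
of `1 / (1 - γ)` in the bounds for the estimators. -/
theorem abs_rewardToGo_le {M : MDP S A} {R₀ : ℝ} (hR₀ : 0 < R₀) (hM : M.BoundedReward R₀)
    (τ : Traj S A H) (h : Fin H) :
    |rewardToGo M τ h| ≤ R₀ / (1 - M.γ) * M.γ ^ (h : ℕ) := by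
  have hγ := M.γ_pos
  calc |rewardToGo M τ h| ≤ ∑ t ∈ Finset.Ici h, |M.γ ^ (t : ℕ) * M.r (τ t).1 (τ t).2| :=
        Finset.abs_sum_le_sum_abs _ _
    _ ≤ ∑ t ∈ Finset.Ici h, M.γ ^ (t : ℕ) * R₀ := by
        refine Finset.sum_le_sum fun t _ => ?_
        rw [abs_mul, abs_of_pos (pow_pos hγ _)]
        exact mul_le_mul_of_nonneg_left (hM _ _).le (pow_pos hγ _).le
    _ = (∑ t ∈ Finset.Ico (h : ℕ) H, M.γ ^ t) * R₀ := by
        rw [← Finset.sum_mul, ← Fin.map_valEmbedding_Ici, Finset.sum_map]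
        rfl
    _ ≤ M.γ ^ (h : ℕ) / (1 - M.γ) * R₀ :=
        mul_le_mul_of_nonneg_right (geom_sum_Ico_le_of_lt_one hγ.le M.γ_lt_one) hR₀.le
    _ = R₀ / (1 - M.γ) * M.γ ^ (h : ℕ) := by ring

theorem sum_discount_le (M : MDP S A) (H : ℕ) :
    ∑ h : Fin H, M.γ ^ (h : ℕ) ≤ 1 / (1 - M.γ) := by
  rw [Fin.sum_univ_eq_sum_range (fun i => M.γ ^ i), Finset.range_eq_Ico]
  simpa using geom_sum_Ico_le_of_lt_one (m := 0) (n := H) M.γ_pos.le M.γ_lt_one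

theorem abs_ret_le {M : MDP S A} {R₀ : ℝ} (hR₀ : 0 < R₀) (hM : M.BoundedReward R₀)
    (τ : Traj S A H) : |ret M τ| ≤ R₀ / (1 - M.γ) := by
  have hγ := M.γ_pos
  calc |ret M τ| ≤ ∑ t : Fin H, |M.γ ^ (t : ℕ) * M.r (τ t).1 (τ t).2| :=
        Finset.abs_sum_le_sum_abs _ _
    _ ≤ ∑ t : Fin H, M.γ ^ (t : ℕ) * R₀ := by
        refine Finset.sum_le_sum fun t _ => ?_
        rw [abs_mul, abs_of_pos (pow_pos hγ _)]
        exact mul_le_mul_of_nonneg_left (hM _ _).le (pow_pos hγ _).le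
    _ = (∑ t : Fin H, M.γ ^ (t : ℕ)) * R₀ := by rw [Finset.sum_mul]
    _ ≤ 1 / (1 - M.γ) * R₀ := mul_le_mul_of_nonneg_right (sum_discount_le M H) hR₀.le
    _ = R₀ / (1 - M.γ) := by ring

/-- A sum weighted by rewards-to-go is bounded by `C R₀ / (1 - γ)²` if its terms are bounded by
`C`. -/
theorem norm_sum_rewardToGo_smul_le {M : MDP S A} {R₀ : ℝ} (hR₀ : 0 < R₀)
    (hM : M.BoundedReward R₀) (τ : Traj S A H) {E : Type*} [NormedAddCommGroup E]
    [NormedSpace ℝ E] {w : Fin H → E} {C : ℝ} (hC0 : 0 ≤ C) (hC : ∀ h, ‖w h‖ ≤ C) :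
    ‖∑ h, rewardToGo M τ h • w h‖ ≤ C * R₀ / (1 - M.γ) ^ 2 := by
  have h1 : 0 < 1 - M.γ := sub_pos.2 M.γ_lt_one
  have hγ := M.γ_pos
  calc ‖∑ h, rewardToGo M τ h • w h‖ ≤ ∑ h, ‖rewardToGo M τ h • w h‖ := norm_sum_le _ _
    _ ≤ ∑ h : Fin H, R₀ / (1 - M.γ) * M.γ ^ (h : ℕ) * C := by
        refine Finset.sum_le_sum fun h _ => ?_
        rw [norm_smul, Real.norm_eq_abs]
        exact mul_le_mul (abs_rewardToGo_le hR₀ hM τ h) (hC h) (norm_nonneg _) (by positivity)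
    _ = R₀ / (1 - M.γ) * C * ∑ h : Fin H, M.γ ^ (h : ℕ) := by
        rw [Finset.mul_sum]; exact Finset.sum_congr rfl fun _ _ => by ring
    _ ≤ R₀ / (1 - M.γ) * C * (1 / (1 - M.γ)) :=
        mul_le_mul_of_nonneg_left (sum_discount_le M H) (by positivity)
    _ = C * R₀ / (1 - M.γ) ^ 2 := by field_simp

theorem ret_cons (M : MDP S A) (x : S × A) (τ : Traj S A H) :
    ret M (Fin.cons x τ : Traj S A (H + 1)) = M.r x.1 x.2 + M.γ * ret M τ := by
  simp [ret, Fin.sum_univ_succ, Finset.mul_sum, pow_succ', mul_assoc]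

theorem rewardToGo_zero (M : MDP S A) (τ : Traj S A (H + 1)) : rewardToGo M τ 0 = ret M τ := by
  have : Finset.Ici (0 : Fin (H + 1)) = Finset.univ := by ext i; simp
  rw [rewardToGo, this, ret]

theorem rewardToGo_cons_succ (M : MDP S A) (x : S × A) (τ : Traj S A H) (h : Fin H) :
    rewardToGo M (Fin.cons x τ : Traj S A (H + 1)) h.succ = M.γ * rewardToGo M τ h := by
  have e : ∀ {n : ℕ} (i : Fin n), Finset.Ici i = Finset.univ.filter (i ≤ ·) := by
    intro n i; ext j; simp
  rw [rewardToGo, rewardToGo, e, e, Finset.sum_filter, Finset.sum_filter, Fin.sum_univ_succ,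
    Finset.mul_sum]
  simp [Fin.succ_le_succ_iff, pow_succ', mul_assoc]

end Rewards

variable {p : PolicyFamily S A d} {G L : ℝ}

/-- A Carathéodory function: continuous in the parameter and measurable in the state-action pair. -/
theorem measurable_logDens_uncurry (hp : p.Regular G L) :
    Measurable (Function.uncurry fun (x : S × A) θ => p.logDens x.1 x.2 θ) :=
  (measurable_uncurry_of_continuous_of_measurable
    (u := fun (θ : Param d) (x : S × A) => p.logDens x.1 x.2 θ)
    (fun x => (hp.differentiable_log x.1 x.2).continuous)
    (fun θ => measurable_logDens p θ)).comp measurable_swap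

theorem measurable_gradient_logDens (hp : p.Regular G L) :
    Measurable fun z : (S × A) × Param d => gradient (p.logDens z.1.1 z.1.2) z.2 :=
  measurable_gradient_uncurry (f := fun (x : S × A) θ => p.logDens x.1 x.2 θ)
    (measurable_logDens_uncurry hp) fun x => hp.differentiable_log x.1 x.2

theorem measurable_logLik_uncurry (hp : p.Regular G L) :
    Measurable (Function.uncurry fun (τ : Traj S A H) θ => logLik p τ θ) := by
  unfold logLik
  exact Finset.measurable_fun_sum _ fun h _ => (measurable_logDens_uncurry hp).comp
    (f := fun z : Traj S A H × Param d => (z.1 h, z.2))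
    (((measurable_pi_apply h).comp measurable_fst).prodMk measurable_snd)

theorem differentiable_logLik (hp : p.Regular G L) (τ : Traj S A H) :
    Differentiable ℝ (logLik p τ) :=
  Differentiable.fun_sum fun h _ => hp.differentiable_log (τ h).1 (τ h).2

theorem gradient_logLik (hp : p.Regular G L) (τ : Traj S A H) (θ : Param d) :
    gradient (logLik p τ) θ = ∑ h, gradient (p.logDens (τ h).1 (τ h).2) θ := by
  have h1 : fderiv ℝ (logLik p τ) θ = ∑ h, fderiv ℝ (p.logDens (τ h).1 (τ h).2) θ :=
    fderiv_fun_sum fun h _ => hp.differentiable_log (τ h).1 (τ h).2 θ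
  simp [gradient, h1, map_sum]

theorem norm_gradient_logLik_le (hp : p.Regular G L) (τ : Traj S A H) (θ : Param d) :
    ‖gradient (logLik p τ) θ‖ ≤ H * G := by
  rw [gradient_logLik hp]
  refine (norm_sum_le _ _).trans ?_
  refine (Finset.sum_le_sum fun h _ => hp.grad_le θ (τ h).1 (τ h).2).trans ?_
  simp

theorem norm_fderiv_logLik_le (hp : p.Regular G L) (τ : Traj S A H) (θ : Param d) :
    ‖fderiv ℝ (logLik p τ) θ‖ ≤ H * G := by
  rw [← norm_gradient_eq]; exact norm_gradient_logLik_le hp τ θ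

theorem measurable_gradient_logLik (hp : p.Regular G L) :
    Measurable fun z : Traj S A H × Param d => gradient (logLik p z.1) z.2 :=
  measurable_gradient_uncurry (measurable_logLik_uncurry hp) (differentiable_logLik hp)

theorem gradient_Phi (M : MDP S A) (hp : p.Regular G L) (τ : Traj S A H) :
    gradient (Phi M p τ) = gradEst M p τ := by
  funext θ
  have h1 : fderiv ℝ (Phi M p τ) θ =
      ∑ h, rewardToGo M τ h • fderiv ℝ (p.logDens (τ h).1 (τ h).2) θ := by
    refine HasFDerivAt.fderiv ?_
    exact HasFDerivAt.fun_sum fun h _ =>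
      (hp.differentiable_log (τ h).1 (τ h).2 θ).hasFDerivAt.const_mul _
  simp [gradient, h1, map_sum, gradEst]

theorem measurable_gradEst (M : MDP S A) (hp : p.Regular G L) :
    Measurable (Function.uncurry fun (τ : Traj S A H) θ => gradEst M p τ θ) := by
  unfold gradEst
  refine Finset.measurable_fun_sum Finset.univ
    (f := fun h (z : Traj S A H × Param d) =>
      rewardToGo M z.1 h • gradient (p.logDens (z.1 h).1 (z.1 h).2) z.2) fun h _ => ?_
  refine ((measurable_rewardToGo M h).comp measurable_fst).smul ?_
  exact (measurable_gradient_logDens hp).comp (f := fun z : Traj S A H × Param d => (z.1 h, z.2))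
    (((measurable_pi_apply h).comp measurable_fst).prodMk measurable_snd)

theorem hasFDerivAt_gradEst (M : MDP S A) (hp : p.Regular G L) (τ : Traj S A H) (θ : Param d) :
    HasFDerivAt (gradEst M p τ)
      (∑ h, rewardToGo M τ h • fderiv ℝ (gradient (p.logDens (τ h).1 (τ h).2)) θ) θ :=
  HasFDerivAt.fun_sum fun h _ =>
    (hp.differentiable_grad (τ h).1 (τ h).2 θ).hasFDerivAt.fun_const_smul _

theorem differentiable_gradEst (M : MDP S A) (hp : p.Regular G L) (τ : Traj S A H) :
    Differentiable ℝ (gradEst M p τ) := fun θ => (hasFDerivAt_gradEst M hp τ θ).differentiableAt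

theorem norm_gradEst_le {M : MDP S A} {R₀ : ℝ} (hR₀ : 0 < R₀) (hM : M.BoundedReward R₀)
    (hG : 0 < G) (hp : p.Regular G L) (τ : Traj S A H) (θ : Param d) :
    ‖gradEst M p τ θ‖ ≤ G * R₀ / (1 - M.γ) ^ 2 :=
  norm_sum_rewardToGo_smul_le hR₀ hM τ hG.le fun h => hp.grad_le θ (τ h).1 (τ h).2

theorem norm_fderiv_gradEst_le {M : MDP S A} {R₀ : ℝ} (hR₀ : 0 < R₀) (hM : M.BoundedReward R₀)
    (hL : 0 < L) (hp : p.Regular G L) (τ : Traj S A H) (θ : Param d) :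
    ‖fderiv ℝ (gradEst M p τ) θ‖ ≤ L * R₀ / (1 - M.γ) ^ 2 := by
  rw [(hasFDerivAt_gradEst M hp τ θ).fderiv]
  exact norm_sum_rewardToGo_smul_le hR₀ hM τ hL.le fun h => hp.hess_le θ (τ h).1 (τ h).2

/-- This is exactly the integrand of `hasFDerivAt_integral_score` for `f = gradEst`, whence the
unbiasedness of `B`. -/
theorem hessEst_eq (M : MDP S A) (hp : p.Regular G L) (τ : Traj S A H) (θ : Param d) :
    hessEst M p τ θ = fderiv ℝ (gradEst M p τ) θ
      + (fderiv ℝ (logLik p τ) θ).smulRight (gradEst M p τ θ) := by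
  have h1 : (fun θ' => Real.log (likelihood p τ θ')) = logLik p τ :=
    funext fun θ' => log_likelihood p τ θ'
  rw [hessEst, h1, gradient_Phi M hp, add_comm]
  congr 2
  ext v
  simp [gradient]

theorem measurable_hessEst (M : MDP S A) (hp : p.Regular G L) :
    Measurable (Function.uncurry fun (τ : Traj S A H) θ => hessEst M p τ θ) := by
  have h1 := measurable_fderiv_uncurry (measurable_gradEst (H := H) M hp)
    (differentiable_gradEst M hp)
  have h2 := measurable_fderiv_uncurry (measurable_logLik_uncurry (H := H) hp)
    (differentiable_logLik hp)
  have hc : Continuous fun q : (Param d →L[ℝ] ℝ) × Param d => q.1.smulRight q.2 :=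
    (ContinuousLinearMap.smulRightL ℝ (Param d) (Param d)).continuous₂
  have h3 := h1.add (hc.measurable.comp (h2.prodMk (measurable_gradEst (H := H) M hp)))
  convert h3 using 1
  funext z
  simp [Function.uncurry, hessEst_eq M hp]

theorem norm_hessEst_le {M : MDP S A} {R₀ : ℝ} (hR₀ : 0 < R₀) (hM : M.BoundedReward R₀)
    (hG : 0 < G) (hL : 0 < L) (hp : p.Regular G L) (τ : Traj S A H) (θ : Param d) :
    ‖hessEst M p τ θ‖ ≤ (H * G ^ 2 * R₀ + L * R₀) / (1 - M.γ) ^ 2 := by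
  rw [hessEst_eq M hp]
  refine (norm_add_le _ _).trans ?_
  rw [ContinuousLinearMap.norm_smulRight_apply]
  have h1 := mul_le_mul (norm_fderiv_logLik_le hp τ θ) (norm_gradEst_le hR₀ hM hG hp τ θ)
    (norm_nonneg _) (by positivity)
  have h2 := norm_fderiv_gradEst_le hR₀ hM hL hp τ θ
  calc _ ≤ L * R₀ / (1 - M.γ) ^ 2 + H * G * (G * R₀ / (1 - M.γ) ^ 2) := add_le_add h2 h1
    _ = _ := by ring

theorem norm_gradEst_sq_le {M : MDP S A} {R₀ : ℝ} (hR₀ : 0 < R₀) (hM : M.BoundedReward R₀)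
    (hG : 0 < G) (hp : p.Regular G L) (τ : Traj S A H) (θ : Param d) :
    ‖gradEst M p τ θ‖ ^ 2 ≤ sigmaGSq G R₀ M.γ := by
  refine (pow_le_pow_left₀ (norm_nonneg _) (norm_gradEst_le hR₀ hM hG hp τ θ) 2).trans_eq ?_
  rw [sigmaGSq, div_pow, ← pow_mul, mul_pow]

/-- The factor `2` is the price of `(a + b)² ≤ 2 (a² + b²)` for the score term and the Hessian term.
-/
theorem norm_hessEst_sq_le {M : MDP S A} {R₀ : ℝ} (hR₀ : 0 < R₀) (hM : M.BoundedReward R₀)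
    (hG : 0 < G) (hL : 0 < L) (hp : p.Regular G L) (τ : Traj S A H) (θ : Param d) :
    ‖hessEst M p τ θ‖ ^ 2 ≤ 2 * sigmaBSq H G L R₀ M.γ := by
  refine (pow_le_pow_left₀ (norm_nonneg _) (norm_hessEst_le hR₀ hM hG hL hp τ θ) 2).trans ?_
  have h1 : 0 < 1 - M.γ := sub_pos.2 M.γ_lt_one
  rw [sigmaBSq, div_pow, ← pow_mul, ← mul_div_assoc]
  gcongr
  nlinarith [sq_nonneg ((H : ℝ) * G ^ 2 * R₀ - L * R₀)]

/-- The score has mean zero: differentiate the total mass, which is constantly `1`. -/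
theorem integral_gradient_logLik (M : MDP S A) (hp : p.Regular G L) (θ : Param d) (s : S) :
    ∫ τ, gradient (logLik p τ) θ ∂trajKernel M p θ H s = 0 := by
  have h := hasFDerivAt_integral_score (m := fun θ => trajKernel M p θ H s)
    (l := fun τ => logLik p τ) (f := fun _ _ => (1 : ℝ)) (K := H * G) (C := 1) (C' := 0)
    (fun θ θ' => trajKernel_eq_withDensity M p θ θ' H s) (measurable_logLik_uncurry hp)
    measurable_const (differentiable_logLik hp) (fun _ => differentiable_const _)
    (norm_fderiv_logLik_le hp) (by simp) (by simp) θ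
  have h0 := h.unique (f := fun θ' => ∫ _, (1 : ℝ) ∂trajKernel M p θ' H s)
    (by simpa using hasFDerivAt_const (1 : ℝ) θ)
  have h2 : ∫ τ, fderiv ℝ (logLik p τ) θ ∂trajKernel M p θ H s = 0 := by
    rw [← h0]
    refine integral_congr_ae (ae_of_all _ fun τ => ?_)
    ext v
    simp
  have h3 := (InnerProductSpace.toDual ℝ (Param d)).symm.toContinuousLinearEquiv.integral_comp_comm
    (μ := trajKernel M p θ H s) (fun τ => fderiv ℝ (logLik p τ) θ)
  rw [h2, map_zero] at h3
  exact h3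

/-- The first action is weighted by the whole return, and every later reward to go is that of the
tail times `γ`. This drives the induction for causality. -/
theorem gradEst_cons (M : MDP S A) (x : S × A) (τ : Traj S A H) (θ : Param d) :
    gradEst M p (Fin.cons x τ : Traj S A (H + 1)) θ =
      ret M (Fin.cons x τ : Traj S A (H + 1)) • gradient (p.logDens x.1 x.2) θ
        + M.γ • gradEst M p τ θ := by
  simp [gradEst, Fin.sum_univ_succ, rewardToGo_zero, rewardToGo_cons_succ, Finset.smul_sum,
    mul_smul]

theorem norm_ret_smul_score_le {M : MDP S A} {R₀ : ℝ} (hR₀ : 0 < R₀) (hM : M.BoundedReward R₀)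
    (hp : p.Regular G L) (τ : Traj S A H) (θ : Param d) :
    ‖ret M τ • gradient (logLik p τ) θ‖ ≤ R₀ / (1 - M.γ) * (H * G) := by
  have h1 : 0 < 1 - M.γ := sub_pos.2 M.γ_lt_one
  rw [norm_smul]
  exact mul_le_mul (abs_ret_le hR₀ hM τ) (norm_gradient_logLik_le hp τ θ) (norm_nonneg _)
    (by positivity)

theorem measurable_gradient_logLik_left (hp : p.Regular G L) (θ : Param d) :
    Measurable fun τ : Traj S A H => gradient (logLik p τ) θ :=
  Measurable.of_uncurry_right (f := fun (τ : Traj S A H) θ => gradient (logLik p τ) θ)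
    (measurable_gradient_logLik hp)

theorem measurable_ret_smul_score (M : MDP S A) (hp : p.Regular G L) (θ : Param d) :
    Measurable fun τ : Traj S A H => ret M τ • gradient (logLik p τ) θ :=
  (measurable_ret M).smul (measurable_gradient_logLik_left hp θ)

theorem measurable_gradEst_left (M : MDP S A) (hp : p.Regular G L) (θ : Param d) :
    Measurable fun τ : Traj S A H => gradEst M p τ θ :=
  (measurable_gradEst M hp).of_uncurry_right

/-- Causality: past rewards do not contribute to the policy gradient. -/
theorem integral_ret_smul_score_sub {M : MDP S A} {R₀ : ℝ} (hR₀ : 0 < R₀)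
    (hM : M.BoundedReward R₀) (hG : 0 < G) (hp : p.Regular G L) (θ : Param d) (H : ℕ) :
    ∀ s : S, ∫ τ : Traj S A H, (ret M τ • gradient (logLik p τ) θ - gradEst M p τ θ)
      ∂trajKernel M p θ H s = 0 := by
  induction H with
  | zero => intro s; simp [ret, gradEst]
  | succ H ih =>
    intro s
    have hmeas : ∀ H : ℕ, Measurable fun τ : Traj S A H =>
        ret M τ • gradient (logLik p τ) θ - gradEst M p τ θ := fun H =>
      (measurable_ret_smul_score M hp θ).sub (measurable_gradEst_left M hp θ)
    have hbound : ∀ (H : ℕ) (τ : Traj S A H),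
        ‖ret M τ • gradient (logLik p τ) θ - gradEst M p τ θ‖
          ≤ R₀ / (1 - M.γ) * (H * G) + G * R₀ / (1 - M.γ) ^ 2 := fun H τ =>
      (norm_sub_le _ _).trans (add_le_add (norm_ret_smul_score_le hR₀ hM hp τ θ)
        (norm_gradEst_le hR₀ hM hG hp τ θ))
    rw [integral_trajKernel_succ M p θ H s (hmeas _).stronglyMeasurable (hbound _)]
    -- The score of the first action carries the full return in both terms and cancels. What remains
    -- is a reward fixed before the tail is drawn times the tail score, of mean zero, plus `γ` times
    -- the same difference for the tail.
    have hcons : ∀ a (τ : Traj S A H),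
        ret M (Fin.cons (s, a) τ : Traj S A (H + 1)) •
            gradient (logLik p (Fin.cons (s, a) τ : Traj S A (H + 1))) θ
          - gradEst M p (Fin.cons (s, a) τ : Traj S A (H + 1)) θ
        = M.r s a • gradient (logLik p τ) θ
          + M.γ • (ret M τ • gradient (logLik p τ) θ - gradEst M p τ θ) := by
      intro a τ
      have h1 : gradient (logLik p (Fin.cons (s, a) τ : Traj S A (H + 1))) θ
          = gradient (p.logDens s a) θ + gradient (logLik p τ) θ := by
        rw [gradient_logLik hp, gradient_logLik hp, Fin.sum_univ_succ]; simp
      rw [h1, gradEst_cons, ret_cons]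
      module
    have hzero : ∀ a s', ∫ τ, (ret M (Fin.cons (s, a) τ : Traj S A (H + 1)) •
            gradient (logLik p (Fin.cons (s, a) τ : Traj S A (H + 1))) θ
          - gradEst M p (Fin.cons (s, a) τ : Traj S A (H + 1)) θ) ∂trajKernel M p θ H s' = 0 := by
      intro a s'
      simp_rw [hcons]
      have i1 : Integrable (fun τ : Traj S A H => gradient (logLik p τ) θ)
          (trajKernel M p θ H s') :=
        Integrable.of_bound (measurable_gradient_logLik_left hp θ).aestronglyMeasurable (H * G)
          (ae_of_all _ fun τ => norm_gradient_logLik_le hp τ θ)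
      have i2 : Integrable (fun τ : Traj S A H =>
          ret M τ • gradient (logLik p τ) θ - gradEst M p τ θ) (trajKernel M p θ H s') :=
        Integrable.of_bound (hmeas H).aestronglyMeasurable _ (ae_of_all _ (hbound H))
      rw [integral_add (i1.fun_smul (M.r s a)) (i2.fun_smul M.γ), integral_smul, integral_smul, ih,
        integral_gradient_logLik M hp]
      simp
    simp [hzero]

/-- Policy gradient theorem: the expected return is differentiable, and `g(τ; θ)` is an unbiased
estimate of its gradient. -/
theorem hasGradientAt_J {M : MDP S A} {R₀ : ℝ} (hR₀ : 0 < R₀) (hM : M.BoundedReward R₀)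
    (hG : 0 < G) (hp : p.Regular G L) (H : ℕ) (θ : Param d) :
    HasGradientAt (J M p H) (∫ τ, gradEst M p τ θ ∂trajLaw M p H θ) θ := by
  have h := hasFDerivAt_integral_score (m := trajLaw M p H)
    (l := fun τ => logLik p τ) (f := fun τ _ => ret M τ) (K := H * G) (C := R₀ / (1 - M.γ))
    (C' := 0) (trajLaw_eq_withDensity M p H) (measurable_logLik_uncurry hp)
    ((measurable_ret M).comp measurable_fst) (differentiable_logLik hp)
    (fun _ => differentiable_const _) (norm_fderiv_logLik_le hp)
    (fun τ _ => abs_ret_le hR₀ hM τ) (by simp) θ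
  have hg : HasGradientAt (J M p H) _ θ := h.hasGradientAt
  convert hg using 1
  have hint1 : Integrable (fun τ : Traj S A H => gradEst M p τ θ) (trajLaw M p H θ) :=
    Integrable.of_bound (measurable_gradEst_left M hp θ).aestronglyMeasurable _
      (ae_of_all _ fun τ => norm_gradEst_le hR₀ hM hG hp τ θ)
  have hint2 : Integrable (fun τ : Traj S A H => ret M τ • gradient (logLik p τ) θ)
      (trajLaw M p H θ) :=
    Integrable.of_bound (measurable_ret_smul_score M hp θ).aestronglyMeasurable _
      (ae_of_all _ fun τ => norm_ret_smul_score_le hR₀ hM hp τ θ)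
  have hint3 : Integrable (fun τ : Traj S A H =>
      ret M τ • gradient (logLik p τ) θ - gradEst M p τ θ) (trajLaw M p H θ) := hint2.sub hint1
  -- The score formula gives return times score; causality, integrated over the starting state,
  -- identifies its mean with that of `gradEst`.
  have h1 : ∫ τ : Traj S A H, ret M τ • gradient (logLik p τ) θ ∂trajLaw M p H θ
      = ∫ τ, gradEst M p τ θ ∂trajLaw M p H θ := by
    rw [← sub_eq_zero, ← integral_sub hint2 hint1, integral_trajLaw _ _ _ _ hint3]
    simp [integral_ret_smul_score_sub hR₀ hM hG hp θ H]
  have h3 := (InnerProductSpace.toDual ℝ (Param d)).symm.toContinuousLinearEquiv.integral_comp_comm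
    (μ := trajLaw M p H θ) (fun τ => fderiv ℝ (fun _ : Param d => ret M τ) θ
      + (fderiv ℝ (logLik p τ) θ).smulRight (ret M τ))
  rw [← h1]
  refine Eq.trans ?_ h3
  refine integral_congr_ae (ae_of_all _ fun τ => ?_)
  have h4 : fderiv ℝ (fun _ : Param d => ret M τ) θ
      + (fderiv ℝ (logLik p τ) θ).smulRight (ret M τ) = ret M τ • fderiv ℝ (logLik p τ) θ := by
    ext v; simp [mul_comm]
  simp only [h4]
  simp [gradient]

theorem gradient_J_eq {M : MDP S A} {R₀ : ℝ} (hR₀ : 0 < R₀) (hM : M.BoundedReward R₀)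
    (hG : 0 < G) (hp : p.Regular G L) (H : ℕ) (θ : Param d) :
    gradient (J M p H) θ = ∫ τ, gradEst M p τ θ ∂trajLaw M p H θ :=
  (hasGradientAt_J hR₀ hM hG hp H θ).gradient

theorem norm_gradient_J_le {M : MDP S A} {R₀ : ℝ} (hR₀ : 0 < R₀) (hM : M.BoundedReward R₀)
    (hG : 0 < G) (hp : p.Regular G L) (H : ℕ) (θ : Param d) :
    ‖gradient (J M p H) θ‖ ≤ G * R₀ / (1 - M.γ) ^ 2 := by
  rw [gradient_J_eq hR₀ hM hG hp]
  simpa using norm_integral_le_of_norm_le_const (μ := trajLaw M p H θ)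
    (ae_of_all _ fun τ => norm_gradEst_le hR₀ hM hG hp τ θ)

/-- `B(τ; θ)` is an unbiased estimate of the Hessian of the expected return. -/
theorem hasFDerivAt_gradient_J {M : MDP S A} {R₀ : ℝ} (hR₀ : 0 < R₀) (hM : M.BoundedReward R₀)
    (hG : 0 < G) (hL : 0 < L) (hp : p.Regular G L) (H : ℕ) (θ : Param d) :
    HasFDerivAt (gradient (J M p H)) (∫ τ, hessEst M p τ θ ∂trajLaw M p H θ) θ := by
  have h := hasFDerivAt_integral_score (m := trajLaw M p H)
    (l := fun τ => logLik p τ) (f := fun τ => gradEst M p τ) (trajLaw_eq_withDensity M p H)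
    (measurable_logLik_uncurry hp) (measurable_gradEst M hp) (differentiable_logLik hp)
    (differentiable_gradEst M hp) (norm_fderiv_logLik_le hp)
    (norm_gradEst_le hR₀ hM hG hp) (norm_fderiv_gradEst_le hR₀ hM hL hp) θ
  simp_rw [← hessEst_eq M hp] at h
  rwa [funext fun θ => gradient_J_eq hR₀ hM hG hp H θ]

theorem norm_fderiv_gradient_J_le {M : MDP S A} {R₀ : ℝ} (hR₀ : 0 < R₀)
    (hM : M.BoundedReward R₀) (hG : 0 < G) (hL : 0 < L) (hp : p.Regular G L) (H : ℕ)
    (θ : Param d) :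
    ‖fderiv ℝ (gradient (J M p H)) θ‖ ≤ (H * G ^ 2 * R₀ + L * R₀) / (1 - M.γ) ^ 2 := by
  rw [(hasFDerivAt_gradient_J hR₀ hM hG hL hp H θ).fderiv]
  simpa using norm_integral_le_of_norm_le_const (μ := trajLaw M p H θ)
    (ae_of_all _ fun τ => norm_hessEst_le hR₀ hM hG hL hp τ θ)

theorem differentiable_gradient_J {M : MDP S A} {R₀ : ℝ} (hR₀ : 0 < R₀)
    (hM : M.BoundedReward R₀) (hG : 0 < G) (hL : 0 < L) (hp : p.Regular G L) (H : ℕ) :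
    Differentiable ℝ (gradient (J M p H)) := fun θ =>
  (hasFDerivAt_gradient_J hR₀ hM hG hL hp H θ).differentiableAt

/-- All laws have jointly measurable densities with respect to the law at parameter `0`, so Tonelli
applies. This is what makes the family of laws a kernel. -/
theorem measurable_trajLaw_apply (M : MDP S A) (hp : p.Regular G L) (H : ℕ)
    {U : Set (Traj S A H)} (hU : MeasurableSet U) :
    Measurable fun θ => trajLaw M p H θ U := by
  have h : ∀ θ, trajLaw M p H θ U =
      ∫⁻ τ in U, ENNReal.ofReal (Real.exp (logLik p τ θ - logLik p τ 0)) ∂trajLaw M p H 0 := by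
    intro θ
    rw [trajLaw_eq_withDensity M p H 0 θ, withDensity_apply _ hU]
  simp_rw [h]
  refine Measurable.lintegral_prod_right'
    (f := fun z : Param d × Traj S A H =>
      ENNReal.ofReal (Real.exp (logLik p z.2 z.1 - logLik p z.2 0))) ?_
  have h1 := (measurable_logLik_uncurry (H := H) hp).comp measurable_swap
  have h2 := (measurable_logLik p (H := H) 0).comp
    (measurable_snd : Measurable (Prod.snd : Param d × Traj S A H → Traj S A H))
  exact (Real.measurable_exp.comp (h1.sub h2)).ennreal_ofReal

/-- The trajectory distribution as a Markov kernel from parameters to trajectories. -/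
def lawKernel (M : MDP S A) (hp : p.Regular G L) (H : ℕ) : Kernel (Param d) (Traj S A H) where
  toFun := trajLaw M p H
  measurable' := Measure.measurable_of_measurable_coe _ fun _ hU =>
    measurable_trajLaw_apply M hp H hU

theorem lawKernel_apply (M : MDP S A) (hp : p.Regular G L) (H : ℕ) (θ : Param d) :
    lawKernel M hp H θ = trajLaw M p H θ := rfl

instance (M : MDP S A) (hp : p.Regular G L) (H : ℕ) : IsMarkovKernel (lawKernel M hp H) :=
  ⟨fun θ => by rw [lawKernel_apply]; infer_instance⟩

end Estimators


/-! ### Second-moment inequalities in an inner product space. -/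

section SecondMoments

variable {Ω E : Type*} [MeasurableSpace Ω] {μ : Measure Ω} [NormedAddCommGroup E]
  [InnerProductSpace ℝ E]

/-- Centering removes `‖m‖²` from the second moment. It serves both for the initial error and for
the final variance bound. -/
theorem integral_norm_sub_integral_sq_le [CompleteSpace E] [IsProbabilityMeasure μ] {X : Ω → E}
    (hX : MemLp X 2 μ) :
    ∫ ω, ‖X ω - ∫ ω', X ω' ∂μ‖ ^ 2 ∂μ ≤ ∫ ω, ‖X ω‖ ^ 2 ∂μ := by
  set m := ∫ ω', X ω' ∂μ with hm
  have hi : Integrable X μ := hX.integrable one_le_two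
  have h2 : Integrable (fun ω => ‖X ω‖ ^ 2) μ := hX.norm.integrable_sq
  have h3 : Integrable (fun ω => 2 * inner ℝ m (X ω)) μ := (hi.const_inner m).const_mul 2
  have e : ∀ ω, ‖X ω - m‖ ^ 2 = ‖X ω‖ ^ 2 - 2 * inner ℝ m (X ω) + ‖m‖ ^ 2 := by
    intro ω
    rw [norm_sub_sq_real, real_inner_comm]
  have h23 : Integrable (fun ω => ‖X ω‖ ^ 2 - 2 * inner ℝ m (X ω)) μ := h2.sub h3
  simp_rw [e]
  rw [integral_add h23 (integrable_const _), integral_sub h2 h3, integral_const_mul,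
    integral_inner hi, ← hm, real_inner_self_eq_norm_sq]
  simp only [integral_const, probReal_univ, smul_eq_mul, one_mul]
  linarith [sq_nonneg ‖m‖]

/-- Second moment of a corrected momentum step: `U` and `g` estimate `u` and `q` without bias
against `e`, `u` and `q`. -/
theorem integral_norm_sq_momentum_step_le {e U u g q : Ω → E} (he : MemLp e 2 μ)
    (hU : MemLp U 2 μ) (hu : MemLp u 2 μ) (hg : MemLp g 2 μ) (hq : MemLp q 2 μ) (c a : ℝ)
    (heU : ∫ ω, inner ℝ (e ω) (U ω) ∂μ = ∫ ω, inner ℝ (e ω) (u ω) ∂μ)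
    (huU : ∫ ω, inner ℝ (u ω) (U ω) ∂μ = ∫ ω, inner ℝ (u ω) (u ω) ∂μ)
    (heg : ∫ ω, inner ℝ (e ω) (g ω) ∂μ = ∫ ω, inner ℝ (e ω) (q ω) ∂μ)
    (hqg : ∫ ω, inner ℝ (q ω) (g ω) ∂μ = ∫ ω, inner ℝ (q ω) (q ω) ∂μ) :
    ∫ ω, ‖c • e ω + (c • (U ω - u ω) + a • (g ω - q ω))‖ ^ 2 ∂μ ≤
      c ^ 2 * ∫ ω, ‖e ω‖ ^ 2 ∂μ + 2 * c ^ 2 * ∫ ω, ‖U ω‖ ^ 2 ∂μ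
        + 2 * a ^ 2 * ∫ ω, ‖g ω‖ ^ 2 ∂μ := by
  have hin : ∀ {f h : Ω → E}, MemLp f 2 μ → MemLp h 2 μ →
      Integrable (fun ω => inner ℝ (f ω) (h ω)) μ := fun hf hh =>
    (hf.norm.integrable_mul hh.norm).mono' (hf.1.inner hh.1)
      (ae_of_all _ fun ω => norm_inner_le_norm _ _)
  have hsq : ∀ {f : Ω → E}, MemLp f 2 μ → Integrable (fun ω => ‖f ω‖ ^ 2) μ :=
    fun hf => hf.norm.integrable_sq
  have hzero : ∀ {f h k : Ω → E}, MemLp f 2 μ → MemLp h 2 μ → MemLp k 2 μ →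
      ∫ ω, inner ℝ (f ω) (h ω) ∂μ = ∫ ω, inner ℝ (f ω) (k ω) ∂μ →
      Integrable (fun ω => inner ℝ (f ω) (h ω - k ω)) μ ∧
        ∫ ω, inner ℝ (f ω) (h ω - k ω) ∂μ = 0 := by
    intro f h k hf hh hk heq
    refine ⟨hin hf (hh.sub hk), ?_⟩
    simp_rw [inner_sub_right]
    rw [integral_sub (hin hf hh) (hin hf hk), heq, sub_self]
  obtain ⟨i1, z1⟩ := hzero he hU hu heU
  obtain ⟨i2, z2⟩ := hzero hu hU hu huU
  obtain ⟨i3, z3⟩ := hzero he hg hq heg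
  obtain ⟨i4, z4⟩ := hzero hq hg hq hqg
  -- With `W = U - u` and `Z = g - q`, the parallelogram inequality `h1` absorbs the correlation of
  -- `W` and `Z` and causes the factors `2`. Replacing `‖W‖²` by `‖U‖² - 2⟨u, W⟩ - ‖u‖²`, and
  -- likewise for `Z`, causes the coefficients `-4`. The four inner products left over all integrate
  -- to zero.
  have hpt : ∀ ω, ‖c • e ω + (c • (U ω - u ω) + a • (g ω - q ω))‖ ^ 2 ≤
      c ^ 2 * ‖e ω‖ ^ 2 + 2 * c ^ 2 * ‖U ω‖ ^ 2 + 2 * a ^ 2 * ‖g ω‖ ^ 2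
        + (2 * c ^ 2) * inner ℝ (e ω) (U ω - u ω) + (-4 * c ^ 2) * inner ℝ (u ω) (U ω - u ω)
        + (2 * c * a) * inner ℝ (e ω) (g ω - q ω)
        + (-4 * a ^ 2) * inner ℝ (q ω) (g ω - q ω) := by
    intro ω
    have h1 : 0 ≤ ‖c • (U ω - u ω) - a • (g ω - q ω)‖ ^ 2 := sq_nonneg _
    have h2 : 0 ≤ c ^ 2 * ‖u ω‖ ^ 2 := by positivity
    have h3 : 0 ≤ a ^ 2 * ‖q ω‖ ^ 2 := by positivity
    have hUu : ‖U ω‖ ^ 2 = ‖U ω - u ω‖ ^ 2 + 2 * inner ℝ (u ω) (U ω - u ω) + ‖u ω‖ ^ 2 := by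
      conv_lhs => rw [← sub_add_cancel (U ω) (u ω)]
      rw [norm_add_sq_real, real_inner_comm]
    have hgq : ‖g ω‖ ^ 2 = ‖g ω - q ω‖ ^ 2 + 2 * inner ℝ (q ω) (g ω - q ω) + ‖q ω‖ ^ 2 := by
      conv_lhs => rw [← sub_add_cancel (g ω) (q ω)]
      rw [norm_add_sq_real, real_inner_comm]
    rw [hUu, hgq]
    generalize U ω - u ω = W at *
    generalize g ω - q ω = Z at *
    rw [norm_sub_sq_real] at h1
    rw [norm_add_sq_real, norm_add_sq_real]
    simp only [norm_smul, mul_pow, Real.norm_eq_abs, sq_abs, inner_add_right,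
      real_inner_smul_left, real_inner_smul_right] at h1 ⊢
    nlinarith
  have j1 : Integrable (fun ω => c ^ 2 * ‖e ω‖ ^ 2) μ := (hsq he).const_mul _
  have j2 : Integrable (fun ω => 2 * c ^ 2 * ‖U ω‖ ^ 2) μ := (hsq hU).const_mul _
  have j3 : Integrable (fun ω => 2 * a ^ 2 * ‖g ω‖ ^ 2) μ := (hsq hg).const_mul _
  have k1 := i1.const_mul (2 * c ^ 2)
  have k2 := i2.const_mul (-4 * c ^ 2)
  have k3 := i3.const_mul (2 * c * a)
  have k4 := i4.const_mul (-4 * a ^ 2)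
  have hlhs : Integrable (fun ω => ‖c • e ω + (c • (U ω - u ω) + a • (g ω - q ω))‖ ^ 2) μ :=
    hsq ((he.const_smul c).add (((hU.sub hu).const_smul c).add ((hg.sub hq).const_smul a)))
  refine (integral_mono hlhs
    ((((((j1.add j2).add j3).add k1).add k2).add k3).add k4) hpt).trans_eq ?_
  rw [integral_add' (((((j1.add j2).add j3).add k1).add k2).add k3) k4,
    integral_add' ((((j1.add j2).add j3).add k1).add k2) k3,
    integral_add' (((j1.add j2).add j3).add k1) k2, integral_add' ((j1.add j2).add j3) k1,
    integral_add' (j1.add j2) j3, integral_add' j1 j2]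
  simp only [integral_const_mul, z1, z2, z3, z4, mul_zero, add_zero]

end SecondMoments

/-! ### The iterates: measurability, boundedness and conditional unbiasedness. -/

section Algorithm

variable {S A : Type*} [MeasurableSpace S] [MeasurableSpace A] {d : ℕ} {H : ℕ} {Ω : Type*}
  {M : MDP S A} {p : PolicyFamily S A d} {R₀ G L : ℝ} {α₀ η₀ : ℝ} {θ₀ : Param d}
  {τ : ℕ → Ω → Traj S A H} {b : ℕ → Ω → ℝ} {τb : ℕ → Ω → Traj S A H}

theorem norm_normStep_sub_le {η : ℝ} (hη : 0 ≤ η) (θ v : Param d) :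
    ‖normStep η θ v - θ‖ ≤ η := by
  rw [normStep, add_sub_cancel_left, norm_smul, norm_smul, norm_inv, norm_norm,
    Real.norm_of_nonneg hη]
  exact mul_le_of_le_one_right hη inv_mul_le_one

theorem measurable_normStep (η : ℝ) :
    Measurable fun z : Param d × Param d => normStep η z.1 z.2 := by
  unfold normStep
  fun_prop

theorem measurable_mixPoint :
    Measurable fun z : ℝ × Param d × Param d => mixPoint z.1 z.2.1 z.2.2 := by
  unfold mixPoint
  fun_prop

theorem measurable_gradEst_comp {X : Type*} [MeasurableSpace X] (M : MDP S A)
    (hp : p.Regular G L) {f : X → Traj S A H} {k : X → Param d} (hf : Measurable f)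
    (hk : Measurable k) : Measurable fun x => gradEst M p (f x) (k x) := by
  have h := (measurable_gradEst (H := H) M hp).comp (hf.prodMk hk)
  simpa only [Function.comp_def, Function.uncurry] using h

theorem measurable_hessEst_apply_comp {X : Type*} [MeasurableSpace X] (M : MDP S A)
    (hp : p.Regular G L) {f : X → Traj S A H} {k v : X → Param d} (hf : Measurable f)
    (hk : Measurable k) (hv : Measurable v) :
    Measurable fun x => hessEst M p (f x) (k x) (v x) :=
  (isBoundedBilinearMap_apply (𝕜 := ℝ) (E := Param d) (F := Param d)).continuous.measurable.comp
    (((measurable_hessEst M hp).comp (hf.prodMk hk)).prodMk hv)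

theorem measurable_mixPoint_comp {X : Type*} [MeasurableSpace X] {s : X → ℝ} {k k' : X → Param d}
    (hs : Measurable s) (hk : Measurable k) (hk' : Measurable k') :
    Measurable fun x => mixPoint (s x) (k x) (k' x) :=
  measurable_mixPoint.comp (hs.prodMk (hk.prodMk hk'))

theorem estAt_succ (t : ℕ) (ω : Ω) :
    estAt M p α₀ η₀ θ₀ τ b τb (t + 1) ω = (1 - momentum α₀ (t + 1)) •
        (estAt M p α₀ η₀ θ₀ τ b τb t ω +
          hessEst M p (τb (t + 1) ω)
            (mixPoint (b (t + 1) ω) (paramAt M p α₀ η₀ θ₀ τ b τb (t + 1) ω)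
              (paramAt M p α₀ η₀ θ₀ τ b τb t ω))
            (paramAt M p α₀ η₀ θ₀ τ b τb (t + 1) ω - paramAt M p α₀ η₀ θ₀ τ b τb t ω))
      + momentum α₀ (t + 1) •
        gradEst M p (τ (t + 1) ω) (paramAt M p α₀ η₀ θ₀ τ b τb (t + 1) ω) := rfl

/-- Normalization makes the displacement independent of the size of the gradient estimate. -/
theorem norm_paramAt_succ_sub_le (hη₀ : 0 < η₀) (t : ℕ) (ω : Ω) :
    ‖paramAt M p α₀ η₀ θ₀ τ b τb (t + 1) ω - paramAt M p α₀ η₀ θ₀ τ b τb t ω‖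
      ≤ stepSize η₀ t :=
  norm_normStep_sub_le (stepSize_nonneg hη₀.le t) _ _

/-- Measurability of the iterates with respect to any σ-algebra that measures the samples. -/
theorem measurable_paramAt_estAt [MeasurableSpace Ω] (hp : p.Regular G L) (t : ℕ)
    (hτ : ∀ i ≤ t, Measurable (τ i)) (hb : ∀ i, 1 ≤ i → i ≤ t → Measurable (b i))
    (hτb : ∀ i, 1 ≤ i → i ≤ t → Measurable (τb i)) :
    Measurable (paramAt M p α₀ η₀ θ₀ τ b τb t) ∧ Measurable (estAt M p α₀ η₀ θ₀ τ b τb t) := by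
  induction t with
  | zero =>
    exact ⟨measurable_const, (measurable_gradEst_left M hp θ₀).comp (hτ 0 le_rfl)⟩
  | succ t ih =>
    obtain ⟨h1, h2⟩ := ih (fun i hi => hτ i (hi.trans t.le_succ))
      (fun i h hi => hb i h (hi.trans t.le_succ)) (fun i h hi => hτb i h (hi.trans t.le_succ))
    have h3 : Measurable (paramAt M p α₀ η₀ θ₀ τ b τb (t + 1)) :=
      (measurable_normStep (stepSize η₀ t)).comp (h1.prodMk h2)
    refine ⟨h3, ?_⟩
    exact Measurable.add (Measurable.const_smul (h2.add (measurable_hessEst_apply_comp M hp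
        (hτb (t + 1) (by omega) le_rfl)
        (measurable_mixPoint_comp (hb (t + 1) (by omega) le_rfl) h3 h1) (h3.sub h1)))
          (1 - momentum α₀ (t + 1)))
      (Measurable.const_smul (measurable_gradEst_comp M hp (hτ (t + 1) le_rfl) h3)
        (momentum α₀ (t + 1)))

theorem measurable_sample_history (t : ℕ) {i : ℕ} (h1 : 1 ≤ i) (h2 : i ≤ t) :
    Measurable[history τ b τb t] fun ω => (τ i ω, b i ω, τb i ω) := by
  rw [measurable_iff_comap_le]
  exact le_sup_of_le_right
    (le_iSup₂_of_le (f := fun i (_ : i ∈ Set.Icc 1 t) =>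
      MeasurableSpace.comap (fun ω => (τ i ω, b i ω, τb i ω)) inferInstance) i ⟨h1, h2⟩ le_rfl)

theorem measurable_paramAt_estAt_history (hp : p.Regular G L) (t : ℕ) :
    Measurable[history τ b τb t] (paramAt M p α₀ η₀ θ₀ τ b τb t) ∧
      Measurable[history τ b τb t] (estAt M p α₀ η₀ θ₀ τ b τb t) := by
  refine @measurable_paramAt_estAt _ _ _ _ _ _ _ _ _ _ _ _ _ _ _ _ _ (history τ b τb t) hp t
    (fun i hi => ?_) (fun i h hi => ?_) (fun i h hi => ?_)
  · rcases Nat.eq_zero_or_pos i with rfl | h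
    · rw [measurable_iff_comap_le]
      exact le_sup_left
    · exact measurable_fst.comp (measurable_sample_history t h hi)
  · exact measurable_fst.comp (measurable_snd.comp (measurable_sample_history t h hi))
  · exact measurable_snd.comp (measurable_snd.comp (measurable_sample_history t h hi))

/-- The index shift matters: the next parameter is already determined by the history up to `t`, so
it may be conditioned on when the samples of time `t + 1` are drawn. -/
theorem measurable_paramAt_succ_history (hp : p.Regular G L) (t : ℕ) :
    Measurable[history τ b τb t] (paramAt M p α₀ η₀ θ₀ τ b τb (t + 1)) :=
  (measurable_normStep (stepSize η₀ t)).comp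
    ((measurable_paramAt_estAt_history hp t).1.prodMk (measurable_paramAt_estAt_history hp t).2)

theorem measurable_errAt_history (hR₀ : 0 < R₀) (hM : M.BoundedReward R₀) (hG : 0 < G)
    (hL : 0 < L) (hp : p.Regular G L) (t : ℕ) :
    Measurable[history τ b τb t] (errAt M p α₀ η₀ θ₀ τ b τb t) :=
  (measurable_paramAt_estAt_history hp t).2.sub
    ((differentiable_gradient_J hR₀ hM hG hL hp H).continuous.measurable.comp
      (measurable_paramAt_estAt_history hp t).1)

theorem history_le [m₀ : MeasurableSpace Ω] (hτ : ∀ t, Measurable (τ t))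
    (hb : ∀ t, Measurable (b t)) (hτb : ∀ t, Measurable (τb t)) (t : ℕ) :
    history τ b τb t ≤ m₀ :=
  sup_le (hτ 0).comap_le (iSup₂_le fun i _ => ((hτ i).prodMk ((hb i).prodMk (hτb i))).comap_le)

/-- The bound may depend on `t`; it only provides integrability and admits the error as a bounded
test function. -/
theorem exists_norm_errAt_le (hR₀ : 0 < R₀) (hM : M.BoundedReward R₀) (hG : 0 < G)
    (hL : 0 < L) (hp : p.Regular G L) (hη₀ : 0 < η₀) (t : ℕ) :
    ∃ C, ∀ ω, ‖errAt M p α₀ η₀ θ₀ τ b τb t ω‖ ≤ C := by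
  have hv : ∃ C, ∀ ω, ‖estAt M p α₀ η₀ θ₀ τ b τb t ω‖ ≤ C := by
    induction t with
    | zero => exact ⟨_, fun ω => norm_gradEst_le hR₀ hM hG hp _ _⟩
    | succ t ih =>
      obtain ⟨C, hC⟩ := ih
      refine ⟨|1 - momentum α₀ (t + 1)| * (C + (H * G ^ 2 * R₀ + L * R₀) / (1 - M.γ) ^ 2 *
        stepSize η₀ t) + |momentum α₀ (t + 1)| * (G * R₀ / (1 - M.γ) ^ 2), fun ω => ?_⟩
      rw [estAt_succ]
      refine (norm_add_le _ _).trans (add_le_add ?_ ?_)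
      · rw [norm_smul, Real.norm_eq_abs]
        refine mul_le_mul_of_nonneg_left ((norm_add_le _ _).trans (add_le_add (hC ω) ?_))
          (abs_nonneg _)
        refine (ContinuousLinearMap.le_opNorm _ _).trans ?_
        exact mul_le_mul (norm_hessEst_le hR₀ hM hG hL hp _ _) (norm_paramAt_succ_sub_le hη₀ t ω)
          (norm_nonneg _) (by positivity)
      · rw [norm_smul, Real.norm_eq_abs]
        exact mul_le_mul_of_nonneg_left (norm_gradEst_le hR₀ hM hG hp _ _) (abs_nonneg _)
  obtain ⟨C, hC⟩ := hv
  exact ⟨C + _, fun ω => (norm_sub_le _ _).trans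
    (add_le_add (hC ω) (norm_gradient_J_le hR₀ hM hG hp H _))⟩

/-! ### Averaging out a fresh sample against a function of the past. -/

section Averaging

variable {𝒳 Y E : Type*} {m m₀ : MeasurableSpace Ω} [MeasurableSpace 𝒳] [MeasurableSpace Y]
  {μ : Measure Ω} [IsProbabilityMeasure μ] [NormedAddCommGroup E] [InnerProductSpace ℝ E]
  [MeasurableSpace E] [BorelSpace E] [SecondCountableTopology E] [CompleteSpace E]

/-- Correlation of an `m`-measurable `h` with a function of `(x, y)`, computed by first averaging
over `y` given `m`. -/
theorem integral_inner_comp_of_condExp (hm : m ≤ m₀) {x : Ω → 𝒳} {y : Ω → Y}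
    (hx : Measurable[m] x) (hy : Measurable y) (κ : Kernel 𝒳 Y) [IsMarkovKernel κ]
    (hκ : ∀ U, MeasurableSet U →
      μ[(y ⁻¹' U).indicator (fun _ => (1 : ℝ)) | m] =ᵐ[μ] fun ω => (κ (x ω)).real U)
    {F : 𝒳 × Y → E} (hF : Measurable F) {D : ℝ} (hD : ∀ ω u, ‖F (x ω, u)‖ ≤ D)
    {h : Ω → E} (hh : Measurable[m] h) {C : ℝ} (hC : ∀ ω, ‖h ω‖ ≤ C) :
    ∫ ω, inner ℝ (h ω) (F (x ω, y ω)) ∂μ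
      = ∫ ω, inner ℝ (h ω) (∫ u, F (x ω, u) ∂κ (x ω)) ∂μ := by
  have hf : Measurable fun z : (E × 𝒳) × Y => (inner ℝ z.1.1 (F (z.1.2, z.2)) : ℝ) :=
    (measurable_fst.comp measurable_fst).inner
      (hF.comp ((measurable_snd.comp measurable_fst).prodMk measurable_snd))
  -- The test function is adjoined to the conditioning variable, and the kernel ignores the new
  -- coordinate.
  have hhx : Measurable[m] fun ω => (h ω, x ω) := hh.prodMk hx
  have key := integral_comp_prodMk_of_condExp (μ := μ) hm hhx hy
    (κ.comap Prod.snd measurable_snd) hκ hf ?_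
  · refine key.trans (integral_congr_ae (ae_of_all _ fun ω => ?_))
    simp only [Kernel.comap_apply]
    refine integral_inner ?_ _
    exact Integrable.of_bound (hF.comp measurable_prodMk_left).aestronglyMeasurable D
      (ae_of_all _ (hD ω))
  · refine Integrable.of_bound (hf.comp ((hhx.mono hm le_rfl).prodMk hy)).aestronglyMeasurable
      (C * D) (ae_of_all _ fun ω => (norm_inner_le_norm _ _).trans ?_)
    exact mul_le_mul (hC ω) (hD _ _) (norm_nonneg _) ((norm_nonneg _).trans (hC ω))

/-- The special case of `integral_inner_comp_of_condExp` in which `y` is independent of `m`. -/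
theorem integral_inner_comp_of_indep (hm : m ≤ m₀) {x : Ω → 𝒳} {y : Ω → Y} (hy : Measurable y)
    (hind : Indep m (MeasurableSpace.comap y inferInstance) μ) (hx : Measurable[m] x)
    {F : 𝒳 × Y → E} (hF : Measurable F) {D : ℝ} (hD : ∀ ω u, ‖F (x ω, u)‖ ≤ D)
    {h : Ω → E} (hh : Measurable[m] h) {C : ℝ} (hC : ∀ ω, ‖h ω‖ ≤ C) :
    ∫ ω, inner ℝ (h ω) (F (x ω, y ω)) ∂μ
      = ∫ ω, inner ℝ (h ω) (∫ u, F (x ω, u) ∂μ.map y) ∂μ := by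
  have : IsProbabilityMeasure (μ.map y) := Measure.isProbabilityMeasure_map hy.aemeasurable
  refine integral_inner_comp_of_condExp hm hx hy (Kernel.const 𝒳 (μ.map y)) (fun U hU => ?_) hF hD
    hh hC
  have hU' : StronglyMeasurable[MeasurableSpace.comap y inferInstance]
      ((y ⁻¹' U).indicator fun _ => (1 : ℝ)) :=
    stronglyMeasurable_const.indicator ⟨U, hU, rfl⟩
  refine (condExp_indep_eq hy.comap_le hm hU' hind.symm).trans (ae_of_all _ fun ω => ?_)
  simp [integral_indicator_const, hy hU, Measure.real, Measure.map_apply hy hU]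

end Averaging

/-! ### Unbiasedness along a run of the algorithm. -/

section Run

variable [MeasurableSpace Ω] {μ : Measure Ω} {T : ℕ}

theorem IsRun.history_le (hrun : IsRun μ M p α₀ η₀ θ₀ T τ b τb) (t : ℕ) :
    history τ b τb t ≤ ‹MeasurableSpace Ω› :=
  Sharp.history_le hrun.measurable_τ hrun.measurable_b hrun.measurable_τb t

theorem IsRun.condExp_τ (hrun : IsRun μ M p α₀ η₀ θ₀ T τ b τb) {t : ℕ} (ht : t + 1 < T)
    {U : Set (Traj S A H)} (hU : MeasurableSet U) :
    μ[(τ (t + 1) ⁻¹' U).indicator (fun _ => (1 : ℝ)) |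
        history τ b τb t ⊔ MeasurableSpace.comap (b (t + 1)) inferInstance]
      =ᵐ[μ] fun ω => (trajLaw M p H (paramAt M p α₀ η₀ θ₀ τ b τb (t + 1) ω)).real U := by
  have h := hrun.law_traj t ht U Set.univ hU MeasurableSet.univ
  simpa [Set.preimage] using h

theorem IsRun.condExp_τb (hrun : IsRun μ M p α₀ η₀ θ₀ T τ b τb) {t : ℕ} (ht : t + 1 < T)
    {V : Set (Traj S A H)} (hV : MeasurableSet V) :
    μ[(τb (t + 1) ⁻¹' V).indicator (fun _ => (1 : ℝ)) |
        history τ b τb t ⊔ MeasurableSpace.comap (b (t + 1)) inferInstance]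
      =ᵐ[μ] fun ω => (trajLaw M p H (mixPoint (b (t + 1) ω)
          (paramAt M p α₀ η₀ θ₀ τ b τb (t + 1) ω)
          (paramAt M p α₀ η₀ θ₀ τ b τb t ω))).real V := by
  have h := hrun.law_traj t ht Set.univ V MeasurableSet.univ hV
  simpa [Set.preimage] using h

variable [IsProbabilityMeasure μ]

theorem IsRun.memLp_errAt (hrun : IsRun μ M p α₀ η₀ θ₀ T τ b τb) (hR₀ : 0 < R₀)
    (hM : M.BoundedReward R₀) (hG : 0 < G) (hL : 0 < L) (hp : p.Regular G L) (hη₀ : 0 < η₀)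
    (t : ℕ) : MemLp (errAt M p α₀ η₀ θ₀ τ b τb t) 2 μ := by
  obtain ⟨C, hC⟩ := exists_norm_errAt_le (α₀ := α₀) (θ₀ := θ₀) (τ := τ) (b := b) (τb := τb)
    hR₀ hM hG hL hp hη₀ t
  exact MemLp.of_bound ((measurable_errAt_history hR₀ hM hG hL hp t).mono (hrun.history_le t)
    le_rfl).aestronglyMeasurable C (ae_of_all _ hC)

/-- Given the past, `g(τ_t; θ_t)` is an unbiased estimate of `∇J(θ_t)`. -/
theorem IsRun.integral_inner_gradEst (hrun : IsRun μ M p α₀ η₀ θ₀ T τ b τb) (hR₀ : 0 < R₀)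
    (hM : M.BoundedReward R₀) (hG : 0 < G) (hp : p.Regular G L) {t : ℕ}
    (ht : t + 1 < T) {h : Ω → Param d} (hh : Measurable[history τ b τb t] h) {C : ℝ}
    (hC : ∀ ω, ‖h ω‖ ≤ C) :
    ∫ ω, inner ℝ (h ω) (gradEst M p (τ (t + 1) ω) (paramAt M p α₀ η₀ θ₀ τ b τb (t + 1) ω)) ∂μ
      = ∫ ω, inner ℝ (h ω) (gradient (J M p H) (paramAt M p α₀ η₀ θ₀ τ b τb (t + 1) ω)) ∂μ := by
  have hle := hrun.history_le t
  have hm : history τ b τb t ⊔ MeasurableSpace.comap (b (t + 1)) inferInstance ≤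
      ‹MeasurableSpace Ω› := sup_le hle (hrun.measurable_b _).comap_le
  have hθ := measurable_paramAt_succ_history (M := M) (α₀ := α₀) (η₀ := η₀) (θ₀ := θ₀) (τ := τ)
    (b := b) (τb := τb) hp t
  have key := integral_inner_comp_of_condExp (μ := μ) hm (hθ.mono le_sup_left le_rfl)
    (hrun.measurable_τ (t + 1)) (lawKernel M hp H) (fun U hU => hrun.condExp_τ ht hU)
    (F := fun z : Param d × Traj S A H => gradEst M p z.2 z.1)
    (measurable_gradEst_comp M hp measurable_snd measurable_fst)
    (fun ω u => norm_gradEst_le hR₀ hM hG hp u _) (hh.mono le_sup_left le_rfl) hC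
  simp only [lawKernel_apply, ← gradient_J_eq hR₀ hM hG hp] at key
  exact key

/-- Given the past, `B(τ^b_t; θ^b_t)(θ_t - θ_{t-1})` is an unbiased estimate of
`∇J(θ_t) - ∇J(θ_{t-1})`. -/
theorem IsRun.integral_inner_hessEst (hrun : IsRun μ M p α₀ η₀ θ₀ T τ b τb) (hR₀ : 0 < R₀)
    (hM : M.BoundedReward R₀) (hG : 0 < G) (hL : 0 < L) (hp : p.Regular G L) (hη₀ : 0 < η₀)
    {t : ℕ} (ht : t + 1 < T) {h : Ω → Param d} (hh : Measurable[history τ b τb t] h) {C : ℝ}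
    (hC : ∀ ω, ‖h ω‖ ≤ C) :
    ∫ ω, inner ℝ (h ω) (hessEst M p (τb (t + 1) ω)
        (mixPoint (b (t + 1) ω) (paramAt M p α₀ η₀ θ₀ τ b τb (t + 1) ω)
          (paramAt M p α₀ η₀ θ₀ τ b τb t ω))
        (paramAt M p α₀ η₀ θ₀ τ b τb (t + 1) ω - paramAt M p α₀ η₀ θ₀ τ b τb t ω)) ∂μ
      = ∫ ω, inner ℝ (h ω) (gradient (J M p H) (paramAt M p α₀ η₀ θ₀ τ b τb (t + 1) ω)
          - gradient (J M p H) (paramAt M p α₀ η₀ θ₀ τ b τb t ω)) ∂μ := by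
  have hle := hrun.history_le t
  have hm : history τ b τb t ⊔ MeasurableSpace.comap (b (t + 1)) inferInstance ≤
      ‹MeasurableSpace Ω› := sup_le hle (hrun.measurable_b _).comap_le
  have hθ' := measurable_paramAt_succ_history (M := M) (α₀ := α₀) (η₀ := η₀) (θ₀ := θ₀) (τ := τ)
    (b := b) (τb := τb) hp t
  have hθ := (measurable_paramAt_estAt_history (M := M) (α₀ := α₀) (η₀ := η₀) (θ₀ := θ₀) (τ := τ)
    (b := b) (τb := τb) hp t).1
  have hΔ : ∀ ω, ‖paramAt M p α₀ η₀ θ₀ τ b τb (t + 1) ω - paramAt M p α₀ η₀ θ₀ τ b τb t ω‖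
      ≤ stepSize η₀ t := norm_paramAt_succ_sub_le hη₀ t
  have hB : ∀ θ, ∫ u, hessEst M p u θ ∂trajLaw M p H θ = fderiv ℝ (gradient (J M p H)) θ :=
    fun θ => (hasFDerivAt_gradient_J hR₀ hM hG hL hp H θ).fderiv.symm
  have hbm := hrun.measurable_b (t + 1)
  have hbm' : Measurable[history τ b τb t ⊔ MeasurableSpace.comap (b (t + 1)) inferInstance]
      (b (t + 1)) := measurable_iff_comap_le.2 le_sup_right
  have hcond := fun U hU => hrun.condExp_τb ht (V := U) hU
  have hlaw := hrun.law_b t ht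
  have hindep := hrun.indep_b t ht
  have hτb := hrun.measurable_τb (t + 1)
  generalize paramAt M p α₀ η₀ θ₀ τ b τb (t + 1) = θ' at *
  generalize paramAt M p α₀ η₀ θ₀ τ b τb t = θ at *
  generalize b (t + 1) = β at *
  generalize τb (t + 1) = σ at *
  have hmix : Measurable fun x : ℝ × Param d × Param d => mixPoint x.1 x.2.1 x.2.2 :=
    measurable_mixPoint
  have hx := hbm'.prodMk ((hθ'.mono (le_sup_left (b := MeasurableSpace.comap β inferInstance))
    le_rfl).prodMk (hθ.mono (le_sup_left (b := MeasurableSpace.comap β inferInstance)) le_rfl))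
  -- First averaging: over the trajectory `τ^b`, given the history and `b`. It replaces the
  -- stochastic Hessian by `∇²J` at the mixed point.
  have key := integral_inner_comp_of_condExp (μ := μ) hm hx hτb
    ((lawKernel M hp H).comap (fun x : ℝ × Param d × Param d => mixPoint x.1 x.2.1 x.2.2) hmix)
    hcond
    (F := fun z : (ℝ × Param d × Param d) × Traj S A H =>
      hessEst M p z.2 (mixPoint z.1.1 z.1.2.1 z.1.2.2) (z.1.2.1 - z.1.2.2))
    (measurable_hessEst_apply_comp M hp measurable_snd (hmix.comp measurable_fst) (by fun_prop))
    (D := (H * G ^ 2 * R₀ + L * R₀) / (1 - M.γ) ^ 2 * stepSize η₀ t)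
    (fun ω u => (ContinuousLinearMap.le_opNorm _ _).trans
      (mul_le_mul (norm_hessEst_le hR₀ hM hG hL hp _ _) (hΔ ω) (norm_nonneg _) (by positivity)))
    (hh.mono le_sup_left le_rfl) hC
  simp only [Kernel.comap_apply, lawKernel_apply] at key
  rw [key]
  have happ : ∀ q v : Param d, ∫ u, hessEst M p u q v ∂trajLaw M p H q
      = fderiv ℝ (gradient (J M p H)) q v := by
    intro q v
    rw [← hB q, ContinuousLinearMap.integral_apply]
    exact Integrable.of_bound
      (measurable_hessEst M hp).of_uncurry_right.aestronglyMeasurable _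
      (ae_of_all _ fun u => norm_hessEst_le hR₀ hM hG hL hp u q)
  simp only [happ]
  have hDm : Measurable fun z : ℝ × Param d × Param d =>
      fderiv ℝ (gradient (J M p H)) (mixPoint z.1 z.2.1 z.2.2) (z.2.1 - z.2.2) :=
    (isBoundedBilinearMap_apply (𝕜 := ℝ) (E := Param d) (F := Param d)).continuous.measurable.comp
      (((measurable_fderiv ℝ (gradient (J M p H))).comp hmix).prodMk (by fun_prop))
  have hInd : Indep (history τ b τb t) (MeasurableSpace.comap β inferInstance) μ := hindep.symm
  -- Second averaging: over `b`, given the history alone. Uniformity of `b` makes it the integral of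
  -- `∇²J` along the segment, which is the difference of the gradients.
  rw [integral_inner_comp_of_indep hle hbm hInd (hθ'.prodMk hθ)
    (F := fun z : (Param d × Param d) × ℝ =>
      fderiv ℝ (gradient (J M p H)) (mixPoint z.2 z.1.1 z.1.2) (z.1.1 - z.1.2))
    (hDm.comp (f := fun z : (Param d × Param d) × ℝ => (z.2, z.1)) (by fun_prop))
    (D := (H * G ^ 2 * R₀ + L * R₀) / (1 - M.γ) ^ 2 * stepSize η₀ t)
    (fun ω s => (ContinuousLinearMap.le_opNorm _ _).trans
      (mul_le_mul (norm_fderiv_gradient_J_le hR₀ hM hG hL hp H _) (hΔ ω) (norm_nonneg _)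
        (by positivity))) hh hC, hlaw]
  simp only [integral_fderiv_segment (differentiable_gradient_J hR₀ hM hG hL hp H)
    (norm_fderiv_gradient_J_le hR₀ hM hG hL hp H)]

end Run

end Algorithm


/-! ### The error recursion and its solution. -/

section Recursion

variable {S A : Type*} [MeasurableSpace S] [MeasurableSpace A] {d : ℕ} {H : ℕ} {Ω : Type*}
  {M : MDP S A} {p : PolicyFamily S A d} {R₀ G L : ℝ} {α₀ η₀ : ℝ} {θ₀ : Param d}
  {τ : ℕ → Ω → Traj S A H} {b : ℕ → Ω → ℝ} {τb : ℕ → Ω → Traj S A H}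
  [MeasurableSpace Ω] {μ : Measure Ω} [IsProbabilityMeasure μ] {T : ℕ}

theorem sigmaGSq_nonneg (G R₀ γ : ℝ) : 0 ≤ sigmaGSq G R₀ γ := by
  unfold sigmaGSq; positivity

theorem sigmaBSq_nonneg (H : ℕ) (G L R₀ γ : ℝ) : 0 ≤ sigmaBSq H G L R₀ γ := by
  unfold sigmaBSq; positivity

/-- The initial error is `g(τ_0; θ_0)` minus its mean, so its second moment is at most that of `g`.
-/
theorem IsRun.integral_norm_sq_errAt_zero_le (hrun : IsRun μ M p α₀ η₀ θ₀ T τ b τb)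
    (hR₀ : 0 < R₀) (hM : M.BoundedReward R₀) (hG : 0 < G) (hp : p.Regular G L) :
    ∫ ω, ‖errAt M p α₀ η₀ θ₀ τ b τb 0 ω‖ ^ 2 ∂μ ≤ sigmaGSq G R₀ M.γ := by
  have hm : Measurable fun ω => gradEst M p (τ 0 ω) θ₀ :=
    measurable_gradEst_comp M hp (hrun.measurable_τ 0) measurable_const
  have hL2 : MemLp (fun ω => gradEst M p (τ 0 ω) θ₀) 2 μ :=
    MemLp.of_bound hm.aestronglyMeasurable _ (ae_of_all _ fun ω => norm_gradEst_le hR₀ hM hG hp _ _)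
  have hmean : gradient (J M p H) θ₀ = ∫ ω, gradEst M p (τ 0 ω) θ₀ ∂μ := by
    rw [gradient_J_eq hR₀ hM hG hp, ← hrun.law_init]
    exact integral_map (hrun.measurable_τ 0).aemeasurable
      (measurable_gradEst_left M hp θ₀).aestronglyMeasurable
  have he : ∀ ω, errAt M p α₀ η₀ θ₀ τ b τb 0 ω =
      gradEst M p (τ 0 ω) θ₀ - ∫ ω', gradEst M p (τ 0 ω') θ₀ ∂μ := by
    intro ω
    rw [← hmean]
    rfl
  simp_rw [he]
  refine (integral_norm_sub_integral_sq_le hL2).trans ?_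
  refine (integral_mono hL2.norm.integrable_sq (integrable_const _)
    fun ω => norm_gradEst_sq_le hR₀ hM hG hp (τ 0 ω) θ₀).trans_eq ?_
  simp

theorem IsRun.integral_norm_sq_errAt_succ_le (hrun : IsRun μ M p α₀ η₀ θ₀ T τ b τb)
    (hR₀ : 0 < R₀) (hM : M.BoundedReward R₀) (hG : 0 < G) (hL : 0 < L) (hp : p.Regular G L)
    (hα₀ : 0 ≤ α₀) (hα₀' : α₀ ≤ 1) (hη₀ : 0 < η₀) {t : ℕ} (ht : t + 1 < T) :
    ∫ ω, ‖errAt M p α₀ η₀ θ₀ τ b τb (t + 1) ω‖ ^ 2 ∂μ ≤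
      (1 - momentum α₀ (t + 1)) * ∫ ω, ‖errAt M p α₀ η₀ θ₀ τ b τb t ω‖ ^ 2 ∂μ
        + 8 * sigmaBSq H G L R₀ M.γ * stepSize η₀ t ^ 2
        + 2 * momentum α₀ (t + 1) ^ 2 * sigmaGSq G R₀ M.γ := by
  have hle := hrun.history_le t
  have hJm := (differentiable_gradient_J hR₀ hM hG hL hp H).continuous.measurable
  have hθ' := measurable_paramAt_succ_history (M := M) (α₀ := α₀) (η₀ := η₀) (θ₀ := θ₀) (τ := τ)
    (b := b) (τb := τb) hp t
  have hθ := (measurable_paramAt_estAt_history (M := M) (α₀ := α₀) (η₀ := η₀) (θ₀ := θ₀) (τ := τ)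
    (b := b) (τb := τb) hp t).1
  have hΔ : ∀ ω, ‖paramAt M p α₀ η₀ θ₀ τ b τb (t + 1) ω - paramAt M p α₀ η₀ θ₀ τ b τb t ω‖
      ≤ stepSize η₀ t := norm_paramAt_succ_sub_le hη₀ t
  have hemeas := measurable_errAt_history (α₀ := α₀) (η₀ := η₀) (θ₀ := θ₀) (τ := τ)
    (b := b) (τb := τb) hR₀ hM hG hL hp t
  obtain ⟨C, hC⟩ := exists_norm_errAt_le (α₀ := α₀) (θ₀ := θ₀) (τ := τ) (b := b) (τb := τb)
    hR₀ hM hG hL hp hη₀ t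
  have heL2 := hrun.memLp_errAt hR₀ hM hG hL hp hη₀ t
  set D := G * R₀ / (1 - M.γ) ^ 2
  have hqm : Measurable[history τ b τb t] fun ω =>
      gradient (J M p H) (paramAt M p α₀ η₀ θ₀ τ b τb (t + 1) ω) := hJm.comp hθ'
  have hum : Measurable[history τ b τb t] fun ω =>
      gradient (J M p H) (paramAt M p α₀ η₀ θ₀ τ b τb (t + 1) ω)
        - gradient (J M p H) (paramAt M p α₀ η₀ θ₀ τ b τb t ω) := hqm.sub (hJm.comp hθ)
  have hqb : ∀ ω, ‖gradient (J M p H) (paramAt M p α₀ η₀ θ₀ τ b τb (t + 1) ω)‖ ≤ D :=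
    fun ω => norm_gradient_J_le hR₀ hM hG hp H _
  have hub : ∀ ω, ‖gradient (J M p H) (paramAt M p α₀ η₀ θ₀ τ b τb (t + 1) ω)
        - gradient (J M p H) (paramAt M p α₀ η₀ θ₀ τ b τb t ω)‖ ≤ D + D := fun ω =>
    (norm_sub_le _ _).trans (add_le_add (hqb ω) (norm_gradient_J_le hR₀ hM hG hp H _))
  have hgm : Measurable fun ω =>
      gradEst M p (τ (t + 1) ω) (paramAt M p α₀ η₀ θ₀ τ b τb (t + 1) ω) :=
    measurable_gradEst_comp M hp (hrun.measurable_τ _) (hθ'.mono hle le_rfl)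
  have hUm : Measurable fun ω => hessEst M p (τb (t + 1) ω)
        (mixPoint (b (t + 1) ω) (paramAt M p α₀ η₀ θ₀ τ b τb (t + 1) ω)
          (paramAt M p α₀ η₀ θ₀ τ b τb t ω))
        (paramAt M p α₀ η₀ θ₀ τ b τb (t + 1) ω - paramAt M p α₀ η₀ θ₀ τ b τb t ω) :=
    measurable_hessEst_apply_comp M hp (hrun.measurable_τb _)
      (measurable_mixPoint_comp (hrun.measurable_b _) (hθ'.mono hle le_rfl) (hθ.mono hle le_rfl))
      ((hθ'.mono hle le_rfl).sub (hθ.mono hle le_rfl))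
  have hUb : ∀ ω, ‖hessEst M p (τb (t + 1) ω)
        (mixPoint (b (t + 1) ω) (paramAt M p α₀ η₀ θ₀ τ b τb (t + 1) ω)
          (paramAt M p α₀ η₀ θ₀ τ b τb t ω))
        (paramAt M p α₀ η₀ θ₀ τ b τb (t + 1) ω - paramAt M p α₀ η₀ θ₀ τ b τb t ω)‖ ≤
      (H * G ^ 2 * R₀ + L * R₀) / (1 - M.γ) ^ 2 * stepSize η₀ t := fun ω =>
    (ContinuousLinearMap.le_opNorm _ _).trans
      (mul_le_mul (norm_hessEst_le hR₀ hM hG hL hp _ _) (hΔ ω) (norm_nonneg _) (by positivity))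
  have hUL2 := MemLp.of_bound (μ := μ) (p := 2) hUm.aestronglyMeasurable _ (ae_of_all _ hUb)
  have hgL2 := MemLp.of_bound (μ := μ) (p := 2) hgm.aestronglyMeasurable D
    (ae_of_all _ fun ω => norm_gradEst_le hR₀ hM hG hp _ _)
  have huL2 := MemLp.of_bound (μ := μ) (p := 2) (hum.mono hle le_rfl).aestronglyMeasurable _
    (ae_of_all _ hub)
  have hqL2 := MemLp.of_bound (μ := μ) (p := 2) (hqm.mono hle le_rfl).aestronglyMeasurable _
    (ae_of_all _ hqb)
  have key := integral_norm_sq_momentum_step_le heL2 hUL2 huL2 hgL2 hqL2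
    (1 - momentum α₀ (t + 1)) (momentum α₀ (t + 1))
    (hrun.integral_inner_hessEst hR₀ hM hG hL hp hη₀ ht hemeas hC)
    (hrun.integral_inner_hessEst hR₀ hM hG hL hp hη₀ ht hum hub)
    (hrun.integral_inner_gradEst hR₀ hM hG hp ht hemeas hC)
    (hrun.integral_inner_gradEst hR₀ hM hG hp ht hqm hqb)
  have hU2 : ∫ ω, ‖hessEst M p (τb (t + 1) ω)
        (mixPoint (b (t + 1) ω) (paramAt M p α₀ η₀ θ₀ τ b τb (t + 1) ω)
          (paramAt M p α₀ η₀ θ₀ τ b τb t ω))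
        (paramAt M p α₀ η₀ θ₀ τ b τb (t + 1) ω - paramAt M p α₀ η₀ θ₀ τ b τb t ω)‖ ^ 2 ∂μ
      ≤ 2 * sigmaBSq H G L R₀ M.γ * stepSize η₀ t ^ 2 := by
    refine (integral_mono hUL2.norm.integrable_sq
      (integrable_const (2 * sigmaBSq H G L R₀ M.γ * stepSize η₀ t ^ 2)) fun ω => ?_).trans_eq
      (by simp)
    refine (pow_le_pow_left₀ (norm_nonneg _) (ContinuousLinearMap.le_opNorm _ _) 2).trans ?_
    rw [mul_pow]
    exact mul_le_mul (norm_hessEst_sq_le hR₀ hM hG hL hp _ _)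
      (pow_le_pow_left₀ (norm_nonneg _) (hΔ ω) 2) (by positivity)
      (mul_nonneg zero_le_two (sigmaBSq_nonneg _ _ _ _ _))
  have hg2 : ∫ ω, ‖gradEst M p (τ (t + 1) ω) (paramAt M p α₀ η₀ θ₀ τ b τb (t + 1) ω)‖ ^ 2 ∂μ
      ≤ sigmaGSq G R₀ M.γ := by
    refine (integral_mono hgL2.norm.integrable_sq (integrable_const _)
      fun ω => norm_gradEst_sq_le hR₀ hM hG hp _ _).trans_eq (by simp)
  -- The exact decomposition into contracted old error and two centered noises: `∇J(θ_t)` is added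
  -- and subtracted inside the contracted term.
  have hstep : ∀ ω, errAt M p α₀ η₀ θ₀ τ b τb (t + 1) ω =
      (1 - momentum α₀ (t + 1)) • errAt M p α₀ η₀ θ₀ τ b τb t ω +
        ((1 - momentum α₀ (t + 1)) • (hessEst M p (τb (t + 1) ω)
            (mixPoint (b (t + 1) ω) (paramAt M p α₀ η₀ θ₀ τ b τb (t + 1) ω)
              (paramAt M p α₀ η₀ θ₀ τ b τb t ω))
            (paramAt M p α₀ η₀ θ₀ τ b τb (t + 1) ω - paramAt M p α₀ η₀ θ₀ τ b τb t ω)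
            - (gradient (J M p H) (paramAt M p α₀ η₀ θ₀ τ b τb (t + 1) ω)
              - gradient (J M p H) (paramAt M p α₀ η₀ θ₀ τ b τb t ω)))
          + momentum α₀ (t + 1) •
            (gradEst M p (τ (t + 1) ω) (paramAt M p α₀ η₀ θ₀ τ b τb (t + 1) ω)
              - gradient (J M p H) (paramAt M p α₀ η₀ θ₀ τ b τb (t + 1) ω))) := by
    intro ω
    rw [errAt, errAt, estAt_succ]
    module
  simp_rw [← hstep] at key
  have hm0 := momentum_nonneg hα₀ (t + 1)
  have hm1 := momentum_le_one hα₀ hα₀' (t + 1)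
  have hc0 : 0 ≤ 1 - momentum α₀ (t + 1) := sub_nonneg.2 hm1
  have hc2 : (1 - momentum α₀ (t + 1)) ^ 2 ≤ 1 - momentum α₀ (t + 1) := by nlinarith
  have hc1 : (1 - momentum α₀ (t + 1)) ^ 2 ≤ 1 := by nlinarith
  have hE : 0 ≤ ∫ ω, ‖errAt M p α₀ η₀ θ₀ τ b τb t ω‖ ^ 2 ∂μ :=
    integral_nonneg fun ω => sq_nonneg _
  have hB0 : 0 ≤ 2 * sigmaBSq H G L R₀ M.γ * stepSize η₀ t ^ 2 :=
    mul_nonneg (mul_nonneg zero_le_two (sigmaBSq_nonneg _ _ _ _ _)) (sq_nonneg _)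
  refine key.trans (add_le_add (add_le_add (mul_le_mul_of_nonneg_right hc2 hE) ?_)
    (mul_le_mul_of_nonneg_left hg2 (by positivity)))
  -- The Hessian noise contributes at most `2 * 2 = 4` times `σ_B² η²`; the constant `8` leaves a
  -- factor of two to spare.
  refine (mul_le_mul_of_nonneg_left hU2 (by positivity)).trans ?_
  have := mul_le_mul_of_nonneg_right hc1 hB0
  linarith

theorem IsRun.integral_norm_sq_errAt_le (hrun : IsRun μ M p α₀ η₀ θ₀ T τ b τb)
    (hR₀ : 0 < R₀) (hM : M.BoundedReward R₀) (hG : 0 < G) (hL : 0 < L) (hp : p.Regular G L)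
    (hα₀ : 2 / 3 < α₀) (hα₀' : α₀ ≤ 1) (hη₀ : 0 < η₀) (t : ℕ) (ht : t + 1 < T) :
    ∫ ω, ‖errAt M p α₀ η₀ θ₀ τ b τb (t + 1) ω‖ ^ 2 ∂μ ≤
      (constZ α₀ η₀ (sigmaBSq H G L R₀ M.γ) (sigmaGSq G R₀ M.γ) / (α₀ - 2 / 3))
        / ((t + 1 : ℕ) : ℝ) ^ (2 / 3 : ℝ) := by
  have hσB := sigmaBSq_nonneg H G L R₀ M.γ
  have hσg := sigmaGSq_nonneg G R₀ M.γ
  have hrec : ∀ t, t + 1 < T → ∫ ω, ‖errAt M p α₀ η₀ θ₀ τ b τb (t + 1) ω‖ ^ 2 ∂μ ≤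
      (1 - momentum α₀ (t + 1)) * ∫ ω, ‖errAt M p α₀ η₀ θ₀ τ b τb t ω‖ ^ 2 ∂μ
        + constZ α₀ η₀ (sigmaBSq H G L R₀ M.γ) (sigmaGSq G R₀ M.γ)
          / (((t + 1 : ℕ) : ℝ) ^ (2 / 3 : ℝ)) ^ 2 := by
    intro t ht
    have h1 := hrun.integral_norm_sq_errAt_succ_le hR₀ hM hG hL hp (by linarith) hα₀' hη₀ ht
    have h2 := error_terms_le (α₀ := α₀) (σg := sigmaGSq G R₀ M.γ) hη₀ hσB t
    -- Here `η₀` cancels, leaving noise `C_Z / (t + 1)^{4/3}` in the form required by `decay_step`.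
    have h3 : constZ α₀ η₀ (sigmaBSq H G L R₀ M.γ) (sigmaGSq G R₀ M.γ) / η₀ ^ 2
          * stepSize η₀ (t + 1) ^ 2
        = constZ α₀ η₀ (sigmaBSq H G L R₀ M.γ) (sigmaGSq G R₀ M.γ)
          / (((t + 1 : ℕ) : ℝ) ^ (2 / 3 : ℝ)) ^ 2 := by
      simp only [stepSize, Nat.succ_ne_zero, if_false]
      field_simp
    rw [← h3]
    linarith
  have hzero := hrun.integral_norm_sq_errAt_zero_le hR₀ hM hG hp
  have hZ : 2 * α₀ ^ 2 * sigmaGSq G R₀ M.γ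
      ≤ constZ α₀ η₀ (sigmaBSq H G L R₀ M.γ) (sigmaGSq G R₀ M.γ) := by
    unfold constZ
    have : 0 ≤ 8 * (2 : ℝ) ^ (4 / 3 : ℝ) * η₀ ^ 2 * sigmaBSq H G L R₀ M.γ := by positivity
    linarith
  generalize constZ α₀ η₀ (sigmaBSq H G L R₀ M.γ) (sigmaGSq G R₀ M.γ) = Z at *
  have hα : 0 < α₀ - 2 / 3 := by linarith
  have hZ0 : 0 ≤ Z := le_trans (by positivity) hZ
  induction t with
  | zero =>
    refine (hrec 0 ht).trans ?_
    simp only [momentum, zero_add, one_ne_zero, if_false, Nat.cast_one, Real.one_rpow, div_one,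
      one_pow]
    -- Since `α₀ ≤ 1`, the divisor is at most `1/3`. Of the resulting `3 * Z`, one `Z` covers the
    -- noise of the first step and two cover the initial error.
    have h1 : 3 * Z ≤ Z / (α₀ - 2 / 3) := by
      rw [le_div_iff₀ hα]
      nlinarith
    have h2 : (1 - α₀) * ∫ ω, ‖errAt M p α₀ η₀ θ₀ τ b τb 0 ω‖ ^ 2 ∂μ
        ≤ (1 - α₀) * sigmaGSq G R₀ M.γ := mul_le_mul_of_nonneg_left hzero (by linarith)
    -- From `α₀ > 2/3` one has `4 α₀² > 1 ≥ 1 - α₀`.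
    have h3 : (1 - α₀) * sigmaGSq G R₀ M.γ ≤ 2 * (2 * α₀ ^ 2 * sigmaGSq G R₀ M.γ) := by
      have : 1 - α₀ ≤ 2 * (2 * α₀ ^ 2) := by nlinarith
      nlinarith
    linarith
  | succ t ih =>
    have h1 := hrec (t + 1) ht
    have h2 := ih (by omega)
    have hc : 0 ≤ 1 - momentum α₀ (t + 1 + 1) :=
      sub_nonneg.2 (momentum_le_one (by linarith) hα₀' _)
    -- With `C = Z / (α₀ - 2/3)` the surplus `C * (α₀ - 2/3)` is exactly the noise constant `Z`.
    have h3 := decay_step hα₀ (div_nonneg hZ0 hα.le) (t := t + 1) (by omega)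
    rw [div_mul_cancel₀ _ hα.ne'] at h3
    have h4 := mul_le_mul_of_nonneg_left h2 hc
    have h5 : momentum α₀ (t + 1 + 1) = α₀ / ((t + 1 + 1 : ℕ) : ℝ) ^ (2 / 3 : ℝ) := by
      simp [momentum]
    rw [h5] at h1 h4
    linarith

end Recursion

end Sharp

end

theorem mainTheorem3 {S A : Type*} [MeasurableSpace S] [MeasurableSpace A] {d : ℕ} (H : ℕ)
    (M : Sharp.MDP S A) (p : Sharp.PolicyFamily S A d)
    (R₀ G L : ℝ) (hR₀ : 0 < R₀) (hG : 0 < G) (hL : 0 < L)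
    (hM : M.BoundedReward R₀) (hp : p.Regular G L)
    (α₀ η₀ : ℝ) (hα₀ : 2 / 3 < α₀) (hα₀' : α₀ ≤ 1) (hη₀ : 0 < η₀)
    (θ₀ : Sharp.Param d) (T : ℕ)
    {Ω : Type*} [MeasurableSpace Ω] (μ : Measure Ω) [IsProbabilityMeasure μ]
    (τ : ℕ → Ω → Sharp.Traj S A H) (b : ℕ → Ω → ℝ) (τb : ℕ → Ω → Sharp.Traj S A H)
    (hrun : Sharp.IsRun μ M p α₀ η₀ θ₀ T τ b τb)
    (ε : ℕ → Ω → Sharp.Param d) (hε : ε = Sharp.errAt M p α₀ η₀ θ₀ τ b τb)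
    (σgSq σBSq C_Z : ℝ) (hσg : σgSq = Sharp.sigmaGSq G R₀ M.γ)
    (hσB : σBSq = Sharp.sigmaBSq H G L R₀ M.γ) (hC_Z : C_Z = Sharp.constZ α₀ η₀ σBSq σgSq) :
    Differentiable ℝ (Sharp.J M p H) ∧
    (∀ t < T, MemLp (ε t) 2 μ) ∧
    ∀ t, 1 ≤ t → t < T →
      (∫ ω, ‖ε t ω‖ ^ 2 ∂μ ≤
          (1 - Sharp.momentum α₀ t) * ∫ ω, ‖ε (t - 1) ω‖ ^ 2 ∂μ
            + 8 * σBSq * Sharp.stepSize η₀ (t - 1) ^ 2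
            + 2 * Sharp.momentum α₀ t ^ 2 * σgSq) ∧
      (∫ ω, ‖ε t ω‖ ^ 2 ∂μ ≤
          (1 - Sharp.momentum α₀ t) * ∫ ω, ‖ε (t - 1) ω‖ ^ 2 ∂μ
            + C_Z / η₀ ^ 2 * Sharp.stepSize η₀ t ^ 2) ∧
      (∫ ω, ‖ε t ω‖ ^ 2 ∂μ ≤ (C_Z / (α₀ - 2 / 3)) / (t : ℝ) ^ (2 / 3 : ℝ)) ∧
      (∫ ω, ‖ε t ω - ∫ ω', ε t ω' ∂μ‖ ^ 2 ∂μ ≤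
          (C_Z / (α₀ - 2 / 3)) / (t : ℝ) ^ (2 / 3 : ℝ)) := by
  subst hε hσg hσB hC_Z
  have hmem := hrun.memLp_errAt hR₀ hM hG hL hp hη₀
  refine ⟨fun θ => (Sharp.hasGradientAt_J hR₀ hM hG hp H θ).differentiableAt,
    fun t _ => hmem t, fun t h1 hT => ?_⟩
  obtain ⟨t, rfl⟩ := Nat.exists_eq_add_of_le' h1
  rw [Nat.add_sub_cancel]
  have hrec := hrun.integral_norm_sq_errAt_succ_le hR₀ hM hG hL hp (by linarith) hα₀' hη₀ hT
  have hdecay := hrun.integral_norm_sq_errAt_le hR₀ hM hG hL hp hα₀ hα₀' hη₀ t hT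
  have hterms := Sharp.error_terms_le (α₀ := α₀) (σg := Sharp.sigmaGSq G R₀ M.γ) hη₀
    (Sharp.sigmaBSq_nonneg H G L R₀ M.γ) t
  exact ⟨hrec, by linarith, hdecay,
    (Sharp.integral_norm_sub_integral_sq_le (hmem (t + 1))).trans hdecay⟩
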